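/- Let $\mathcal L$ be an arrangement of $8$ distinct lines in the real plane $\mathbb R^2$, every two of which intersect (no two are parallel). For $k\ge 2$ let $n_k$ be the number of points of the plane that lie on exactly $k$ of the lines. The signature of $\mathcal L$ is the sequence $(n_k)_{k\ge2}$, written $[2^{n_2}\,3^{n_3}\cdots]$ with every $c^0$ omitted. (1) The signatures that occur for such arrangements are exactly the following $28$: $[8^{1}]$, $[2^{7}\,7^{1}]$, $[2^{4}\,3^{6}\,4^{1}]$, $[2^{10}\,3^{1}\,6^{1}]$, $[2^{7}\,3^{3}\,4^{2}]$, $[2^{9}\,3^{3}\,5^{1}]$, $[2^{7}\,3^{5}\,4^{1}]$, $[2^{12}\,4^{1}\,5^{1}]$, $[2^{13}\,6^{1}]$, $[2^{7}\,3^{7}]$, $[2^{10}\,3^{2}\,4^{2}]$, $[2^{12}\,3^{2}\,5^{1}]$, $[2^{10}\,3^{4}\,4^{1}]$, $[2^{10}\,3^{6}]$, $[2^{13}\,3^{1}\,4^{2}]$, $[2^{15}\,3^{1}\,5^{1}]$, $[2^{13}\,3^{3}\,4^{1}]$, $[2^{13}\,3^{5}]$, $[2^{16}\,4^{2}]$,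 $[2^{18}\,5^{1}]$, $[2^{16}\,3^{2}\,4^{1}]$, $[2^{16}\,3^{4}]$, $[2^{19}\,3^{1}\,4^{1}]$, $[2^{19}\,3^{3}]$, $[2^{22}\,4^{1}]$, $[2^{22}\,3^{2}]$, $[2^{25}\,3^{1}]$, $[2^{28}]$. Hence every other solution of $\sum_{k\ge 2} n_k\binom{k}{2}=\binom{8}{2}$ in nonnegative integers is not the signature of such an arrangement. (2) Moreover, no wiring diagram with $8$ wires in which every two wires intersect exactly once has signature $[2^4\,3^8]$. Here a wiring diagram with $\ell$ wires is given by the finite list of its intersection points in order. Each point is recorded by a Lefschetz pair $\langle a,b\rangle$ with $1\le a<b\le\ell$: at the point, the wires which at that moment occupy the positions $a,a+1,\dots,b$ meet, and their order is reversed (position $x$ becomes $a+b-x$). Such a point has multiplicity $b-a+1$, and the signature records the number $n_k$ of points of each multiplicity $k\geq 2$. -/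

import Mathlib

/-- A line of the real plane: the zero set of a nontrivial real equation of degree one. -/
def IsPlaneLine (L : Set (ℝ × ℝ)) : Prop :=
  ∃ a b c : ℝ, (a ≠ 0 ∨ b ≠ 0) ∧ L = {P | a * P.1 + b * P.2 = c}

/-- A real arrangement of `ℓ` (distinct, labelled) lines. -/
structure RealLineArrangement (ℓ : ℕ) where
  line : Fin ℓ → Set (ℝ × ℝ)
  isLine : ∀ i, IsPlaneLine (line i)
  distinct : Function.Injective line

namespace RealLineArrangement

variable {ℓ : ℕ} (A : RealLineArrangement ℓ)

/-- Every two lines of the arrangement intersect (no two of them are parallel). -/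
def PairwiseMeeting : Prop := ∀ i j, (A.line i ∩ A.line j).Nonempty

/-- The number of lines of the arrangement through a given point. -/
noncomputable def multiplicity (P : ℝ × ℝ) : ℕ := {i | P ∈ A.line i}.ncard

/-- The signature `[2^{n₂} 3^{n₃} …]`, as the function `k ↦ n_k` (zero for `k < 2`), where `n_k`
is the number of points through which exactly `k` lines pass. -/
noncomputable def signature (k : ℕ) : ℕ :=
  if 2 ≤ k then {P | A.multiplicity P = k}.ncard else 0

end RealLineArrangement

/-- A Lefschetz pair: the first and the last local index of the wires that meet at a point.
The local indices are numbered from `0` to `ℓ - 1`. -/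
structure LefschetzPair (ℓ : ℕ) where
  first : Fin ℓ
  last : Fin ℓ
  lt : first < last

namespace LefschetzPair

variable {ℓ : ℕ} (p : LefschetzPair ℓ)

/-- The wire at local index `x` passes through the point. -/
def Through (x : Fin ℓ) : Prop := p.first ≤ x ∧ x ≤ p.last

instance (x : Fin ℓ) : Decidable (p.Through x) := by unfold Through; infer_instance

/-- The local index behind the point of the wire that has local index `x` before it: the block
of wires that meet at the point is reversed. -/
def move (x : Fin ℓ) : Fin ℓ :=
  if h : p.Through x then
    ⟨(p.first : ℕ) + (p.last : ℕ) - (x : ℕ), by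
      obtain ⟨h1, h2⟩ := h
      have := p.last.isLt
      simp only [Fin.le_def] at h1 h2
      omega⟩
  else x

/-- The number of wires that meet at the point. -/
def multiplicity : ℕ := (p.last : ℕ) - (p.first : ℕ) + 1

end LefschetzPair

/-- A wiring diagram with `ℓ` wires, given by the list of the Lefschetz pairs of its
intersection points, in order. -/
structure WiringDiagram (ℓ : ℕ) where
  pairs : List (LefschetzPair ℓ)

namespace WiringDiagram

variable {ℓ : ℕ}

/-- The number of points of a list of Lefschetz pairs at which the two wires with initial local
indices `x` and `y` meet. -/
def meetings : List (LefschetzPair ℓ) → Fin ℓ → Fin ℓ → ℕ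
  | [], _, _ => 0
  | p :: ps, x, y =>
      (if p.Through x ∧ p.Through y then 1 else 0) + meetings ps (p.move x) (p.move y)

/-- Every two wires intersect exactly once. -/
def UniqueIntersection (D : WiringDiagram ℓ) : Prop :=
  ∀ x y, x ≠ y → meetings D.pairs x y = 1

/-- The signature `k ↦ n_k`, where `n_k` is the number of points at which exactly `k` wires
meet. -/
def signature (D : WiringDiagram ℓ) (k : ℕ) : ℕ :=
  (D.pairs.map LefschetzPair.multiplicity).count k

end WiringDiagram

/-- The signature `[k^n]`: there are `n` points of multiplicity `k`, and no others. The signature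
`[2^{n₂} 3^{n₃} …]` is the sum `pts 2 n₂ + pts 3 n₃ + …`. -/
def pts (k n : ℕ) : ℕ → ℕ := Pi.single k n

/-! A family of eight lines, any two of which meet in one point, gives a linear space on the set of
lines: a block is the set of lines through a crossing point, and the signature counts blocks by
size. The same holds for wires that meet pairwise exactly once. Counting pairs gives `∑ n_k *
k.choose 2 = 28`. Every other block meets a fixed block `C` in at most one point, so counting pairs
outside `C` bounds the sizes of the other blocks. Together with `n_4 ≤ 2` and `n_3 ≤ 8`, this leaves
the 28 listed signatures and `[2^4 3^8]` (`blockSignature_mem`).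

A linear space of type `[2^4 3^8]` must be the Möbius–Kantor configuration, with blocks `{i, i + 1,
i + 3}` modulo 8. It is excluded by a sign argument. If `ijk` is a block, its determinant vanishes,
and a three-term Grassmann–Plücker relation becomes an equality of two products, that is, a linear
equation over `ZMod 2` between sign bits. These equations force the three terms of one further
Plücker relation to have the same sign, so their sum cannot vanish.

The argument only needs Plücker relations with a common first index, together with alternating
signs. `IsSignDeterminant` isolates this, so one proof serves both settings: for lines `f` is the
3×3 determinant of the equations, for wires it is built from the order of the crossings along the
first wire. The 28 signatures themselves are realized by explicit integer equations. -/

/-- A linear space: a family of blocks with at least two points each, such that every two distinct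
points lie in exactly one block. -/
structure IsLinearSpace {ι : Type*} [DecidableEq ι] (𝓑 : Finset (Finset ι)) : Prop where
  two_le : ∀ B ∈ 𝓑, 2 ≤ B.card
  exists_block : ∀ x y, x ≠ y → ∃ B ∈ 𝓑, x ∈ B ∧ y ∈ B
  eq_block : ∀ B ∈ 𝓑, ∀ C ∈ 𝓑, ∀ x y, x ≠ y → x ∈ B → y ∈ B → x ∈ C → y ∈ C → B = C

/-! ### Counting in linear spaces -/

namespace IsLinearSpace

variable {ι : Type*} [DecidableEq ι] {𝓑 : Finset (Finset ι)}

theorem pairwiseDisjoint_powersetCard (h : IsLinearSpace 𝓑) :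
    (𝓑 : Set (Finset ι)).PairwiseDisjoint (Finset.powersetCard 2) := by
  intro B hB C hC hne
  rw [Function.onFun, Finset.disjoint_left]
  intro s hsB hsC
  rw [Finset.mem_powersetCard] at hsB hsC
  obtain ⟨x, y, hxy, rfl⟩ := Finset.card_eq_two.1 hsB.2
  refine hne (h.eq_block B hB C hC x y hxy ?_ ?_ ?_ ?_)
  · exact hsB.1 (by simp)
  · exact hsB.1 (by simp)
  · exact hsC.1 (by simp)
  · exact hsC.1 (by simp)

theorem card_inter_le_one (h : IsLinearSpace 𝓑) {B C : Finset ι} (hB : B ∈ 𝓑) (hC : C ∈ 𝓑)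
    (hne : B ≠ C) : (B ∩ C).card ≤ 1 := by
  rw [Finset.card_le_one]
  intro x hx y hy
  rw [Finset.mem_inter] at hx hy
  by_contra hxy
  exact hne (h.eq_block B hB C hC x y hxy hx.1 hy.1 hx.2 hy.2)

theorem sum_choose_two [Fintype ι] (h : IsLinearSpace 𝓑) :
    ∑ B ∈ 𝓑, B.card.choose 2 = (Fintype.card ι).choose 2 := by
  rw [← Finset.card_univ, ← Finset.card_powersetCard]
  simp_rw [← Finset.card_powersetCard]
  rw [← Finset.card_biUnion h.pairwiseDisjoint_powersetCard]
  congr 1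
  ext s
  simp only [Finset.mem_biUnion, Finset.mem_powersetCard, Finset.subset_univ, true_and]
  constructor
  · rintro ⟨B, -, -, hs⟩
    exact hs
  · intro hs
    obtain ⟨x, y, hxy, rfl⟩ := Finset.card_eq_two.1 hs
    obtain ⟨B, hB, hx, hy⟩ := h.exists_block x y hxy
    exact ⟨B, hB, by simp [Finset.insert_subset_iff, hx, hy], hs⟩

/-- The pairs of points outside a block bound the other blocks. -/
theorem sum_erase_choose_two_le [Fintype ι] (h : IsLinearSpace 𝓑) {C : Finset ι} (hC : C ∈ 𝓑) :
    ∑ B ∈ 𝓑.erase C, (B.card - 1).choose 2 ≤ (Fintype.card ι - C.card).choose 2 := by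
  calc ∑ B ∈ 𝓑.erase C, (B.card - 1).choose 2
      -- At least `B.card - 1` points of `B` lie outside `C`, and no pair of points lies in two
      -- different blocks.
      ≤ ∑ B ∈ 𝓑.erase C, (Finset.powersetCard 2 (B \ C)).card := by
        refine Finset.sum_le_sum fun B hB => ?_
        rw [Finset.mem_erase] at hB
        rw [Finset.card_powersetCard]
        refine Nat.choose_le_choose 2 ?_
        have h1 := h.card_inter_le_one hB.2 hC hB.1
        have h2 := Finset.card_sdiff_add_card_inter B C
        omega
    _ = ((𝓑.erase C).biUnion fun B => Finset.powersetCard 2 (B \ C)).card := by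
        refine (Finset.card_biUnion fun B hB D hD hne => ?_).symm
        exact (h.pairwiseDisjoint_powersetCard (Finset.mem_of_mem_erase hB)
          (Finset.mem_of_mem_erase hD) hne).mono
          (Finset.powersetCard_mono Finset.sdiff_subset)
          (Finset.powersetCard_mono Finset.sdiff_subset)
    _ ≤ (Finset.powersetCard 2 Cᶜ).card := by
        refine Finset.card_le_card fun s hs => ?_
        obtain ⟨B, -, hs⟩ := Finset.mem_biUnion.1 hs
        refine Finset.powersetCard_mono (fun x hx => ?_) hs
        exact Finset.mem_compl.2 (Finset.mem_sdiff.1 hx).2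
    _ = _ := by rw [Finset.card_powersetCard, Finset.card_compl]

/-- The blocks through `x`, with `x` removed, partition the remaining points. -/
theorem sum_card_sub_one [Fintype ι] (h : IsLinearSpace 𝓑) (x : ι) :
    ∑ B ∈ 𝓑 with x ∈ B, (B.card - 1) = Fintype.card ι - 1 := by
  rw [← Finset.card_univ, ← Finset.card_erase_of_mem (Finset.mem_univ x)]
  have : ∀ B ∈ 𝓑.filter (x ∈ ·), B.card - 1 = (B.erase x).card := fun B hB =>
    (Finset.card_erase_of_mem (Finset.mem_filter.1 hB).2).symm
  rw [Finset.sum_congr rfl this, ← Finset.card_biUnion]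
  · congr 1
    ext y
    simp only [Finset.mem_biUnion, Finset.mem_filter, Finset.mem_erase, Finset.mem_univ, and_true]
    constructor
    · rintro ⟨B, -, hy, -⟩
      exact hy
    · intro hy
      obtain ⟨B, hB, hx, hy'⟩ := h.exists_block x y (Ne.symm hy)
      exact ⟨B, ⟨hB, hx⟩, hy, hy'⟩
  · intro B hB C hC hne
    rw [Function.onFun, Finset.disjoint_left]
    intro y hyB hyC
    rw [Finset.mem_coe, Finset.mem_filter] at hB hC
    rw [Finset.mem_erase] at hyB hyC
    exact hne (h.eq_block B hB.1 C hC.1 x y (Ne.symm hyB.1) hB.2 hyB.2 hC.2 hyC.2)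

theorem card_union_three [Fintype ι] (h : IsLinearSpace 𝓑) {B C D : Finset ι} (hB : B ∈ 𝓑)
    (hC : C ∈ 𝓑) (hD : D ∈ 𝓑) (hBC : B ≠ C) (hBD : B ≠ D) (hCD : C ≠ D) :
    B.card + C.card + D.card ≤ Fintype.card ι + 3 := by
  have h1 := h.card_inter_le_one hB hC hBC
  have h2 := h.card_inter_le_one hB hD hBD
  have h3 := h.card_inter_le_one hC hD hCD
  have h4 := Finset.card_union_add_card_inter B C
  have h5 := Finset.card_union_add_card_inter (B ∪ C) D
  have h6 : ((B ∪ C) ∩ D).card ≤ (B ∩ D).card + (C ∩ D).card := by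
    rw [Finset.union_inter_distrib_right]
    exact Finset.card_union_le _ _
  have h7 := Finset.card_le_univ (B ∪ C ∪ D)
  omega

theorem sum_card_filter_mem [Fintype ι] (𝓑 : Finset (Finset ι)) (k : ℕ) :
    ∑ x, (𝓑.filter fun B => B.card = k ∧ x ∈ B).card = k * (𝓑.filter fun B => B.card = k).card := by
  simp_rw [← Finset.filter_filter, Finset.card_filter (fun B => _ ∈ B)]
  rw [Finset.sum_comm, mul_comm, ← smul_eq_mul, ← Finset.sum_const]
  refine Finset.sum_congr rfl fun B hB => ?_
  simp [(Finset.mem_filter.1 hB).2]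

-- Turns sums over blocks into linear expressions in the numbers `n_k`, to which `omega` applies.
omit [DecidableEq ι] in
theorem sum_comp_card [Fintype ι] (𝓑 : Finset (Finset ι)) (g : ℕ → ℕ) :
    ∑ B ∈ 𝓑, g B.card =
      ∑ k ∈ Finset.range (Fintype.card ι + 1), (𝓑.filter fun B => B.card = k).card * g k := by
  rw [← Finset.sum_fiberwise_of_maps_to (s := 𝓑) (t := Finset.range (Fintype.card ι + 1))
    (g := Finset.card)
    (fun B _ => Finset.mem_range.2 (Nat.lt_succ_of_le (Finset.card_le_univ B)))]
  refine Finset.sum_congr rfl fun k _ => ?_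
  rw [Finset.sum_congr rfl fun B hB => by rw [(Finset.mem_filter.1 hB).2], Finset.sum_const,
    smul_eq_mul]

end IsLinearSpace

/-! ### The numerically possible signatures on eight points -/

/-- The term of a block of size `m` is added to both sides of `sum_erase_choose_two_le`, so that the
left side becomes a sum over all blocks. -/
theorem card_filter_choose_bound {𝓑 : Finset (Finset (Fin 8))} (h : IsLinearSpace 𝓑) (m : ℕ)
    (hm : 0 < (𝓑.filter fun B => B.card = m).card) :
    ∑ B ∈ 𝓑, (B.card - 1).choose 2 ≤ (8 - m).choose 2 + (m - 1).choose 2 := by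
  obtain ⟨B, hB⟩ := Finset.card_pos.1 hm
  obtain ⟨hB, hBm⟩ := Finset.mem_filter.1 hB
  rw [← hBm]
  have h1 := h.sum_erase_choose_two_le hB
  rw [← Finset.sum_erase_add _ _ hB]
  simpa using h1

/-- Three blocks of size four would need at least `12 - 3 = 9` points. -/
theorem card_filter_four_le_two {𝓑 : Finset (Finset (Fin 8))} (h : IsLinearSpace 𝓑) :
    (𝓑.filter fun B => B.card = 4).card ≤ 2 := by
  by_contra hc
  obtain ⟨B, hB, C, hC, D, hD, hBC, hBD, hCD⟩ := Finset.two_lt_card.1 (not_le.1 hc)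
  simp only [Finset.mem_filter] at hB hC hD
  have := h.card_union_three hB.1 hC.1 hD.1 hBC hBD hCD
  simp only [Fintype.card_fin] at this
  omega

/-- A point has seven others to share among its blocks, hence lies on at most three triples; there
are at most `8 * 3` incidences. -/
theorem card_filter_three_le_eight {𝓑 : Finset (Finset (Fin 8))} (h : IsLinearSpace 𝓑) :
    (𝓑.filter fun B => B.card = 3).card ≤ 8 := by
  have h1 := IsLinearSpace.sum_card_filter_mem 𝓑 3
  have h2 : ∀ x, (𝓑.filter fun B => B.card = 3 ∧ x ∈ B).card ≤ 3 := by
    intro x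
    have h3 := h.sum_card_sub_one x
    have h4 : ∑ B ∈ 𝓑.filter (fun B => B.card = 3 ∧ x ∈ B), (B.card - 1) ≤
        ∑ B ∈ 𝓑 with x ∈ B, (B.card - 1) :=
      Finset.sum_le_sum_of_subset (fun B hB => by
        simp only [Finset.mem_filter] at hB ⊢
        exact ⟨hB.1, hB.2.2⟩)
    rw [Finset.sum_congr rfl fun B hB => by rw [(Finset.mem_filter.1 hB).2.1],
      Finset.sum_const, smul_eq_mul, h3, Fintype.card_fin] at h4
    omega
  have h5 := Finset.sum_le_sum fun x (_ : x ∈ Finset.univ) => h2 x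
  rw [h1] at h5
  simp at h5
  omega

/-- The number of blocks of each size of a linear space. -/
def blockSignature (𝓑 : Finset (Finset (Fin 8))) (k : ℕ) : ℕ :=
  (𝓑.filter fun B => B.card = k).card

theorem blockSignature_eq_sum_pts {𝓑 : Finset (Finset (Fin 8))} (h : IsLinearSpace 𝓑) :
    blockSignature 𝓑 = pts 2 (blockSignature 𝓑 2) + pts 3 (blockSignature 𝓑 3) +
      pts 4 (blockSignature 𝓑 4) + pts 5 (blockSignature 𝓑 5) + pts 6 (blockSignature 𝓑 6) +
      pts 7 (blockSignature 𝓑 7) + pts 8 (blockSignature 𝓑 8) := by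
  funext k
  have h0 : k < 2 ∨ 8 < k → blockSignature 𝓑 k = 0 := by
    intro hk
    refine Finset.card_eq_zero.2 (Finset.filter_eq_empty_iff.2 fun B hB hc => ?_)
    have h1 := h.two_le B hB
    have h2 := Finset.card_le_univ B
    simp only [Fintype.card_fin] at h2
    omega
  simp only [Pi.add_apply, pts]
  by_cases hk : k < 2 ∨ 8 < k
  · rw [h0 hk]
    simp only [Pi.single_apply]
    split_ifs <;> omega
  · obtain ⟨h1, h2⟩ : 2 ≤ k ∧ k ≤ 8 := by omega
    interval_cases k <;> simp

theorem blockSignature_mem {𝓑 : Finset (Finset (Fin 8))} (h : IsLinearSpace 𝓑) :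
    blockSignature 𝓑 ∈ ({ pts 8 1, pts 2 7 + pts 7 1, pts 2 4 + pts 3 6 + pts 4 1,
        pts 2 10 + pts 3 1 + pts 6 1,
        pts 2 7 + pts 3 3 + pts 4 2, pts 2 9 + pts 3 3 + pts 5 1, pts 2 7 + pts 3 5 + pts 4 1,
        pts 2 12 + pts 4 1 + pts 5 1, pts 2 13 + pts 6 1, pts 2 7 + pts 3 7,
        pts 2 10 + pts 3 2 + pts 4 2, pts 2 12 + pts 3 2 + pts 5 1,
        pts 2 10 + pts 3 4 + pts 4 1, pts 2 10 + pts 3 6, pts 2 13 + pts 3 1 + pts 4 2,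
        pts 2 15 + pts 3 1 + pts 5 1, pts 2 13 + pts 3 3 + pts 4 1, pts 2 13 + pts 3 5,
        pts 2 16 + pts 4 2, pts 2 18 + pts 5 1, pts 2 16 + pts 3 2 + pts 4 1,
        pts 2 16 + pts 3 4, pts 2 19 + pts 3 1 + pts 4 1, pts 2 19 + pts 3 3,
        pts 2 22 + pts 4 1, pts 2 22 + pts 3 2, pts 2 25 + pts 3 1, pts 2 28 } : Set (ℕ → ℕ)) ∨
    blockSignature 𝓑 = pts 2 4 + pts 3 8 := by
  have e1 := h.sum_choose_two
  rw [IsLinearSpace.sum_comp_card 𝓑 (fun n => n.choose 2)] at e1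
  have e2 := card_filter_choose_bound h
  rw [IsLinearSpace.sum_comp_card 𝓑 (fun n => (n - 1).choose 2)] at e2
  have e3 := card_filter_four_le_two h
  have e4 := card_filter_three_le_eight h
  have b8 := e2 8
  have b7 := e2 7
  have b6 := e2 6
  have b5 := e2 5
  have b4 := e2 4
  simp only [Fintype.card_fin, Finset.sum_range_succ, Finset.sum_range_zero] at e1 b8 b7 b6 b5 b4
  rw [blockSignature_eq_sum_pts h]
  simp only [← blockSignature.eq_1] at *
  generalize blockSignature 𝓑 2 = n2 at *
  generalize blockSignature 𝓑 3 = n3 at *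
  generalize blockSignature 𝓑 4 = n4 at *
  generalize blockSignature 𝓑 5 = n5 at *
  generalize blockSignature 𝓑 6 = n6 at *
  generalize blockSignature 𝓑 7 = n7 at *
  generalize blockSignature 𝓑 8 = n8 at *
  norm_num [Nat.choose] at e1 b8 b7 b6 b5 b4
  have p0 : ∀ k, pts k 0 = 0 := fun k => Pi.single_zero k
  -- A block of size 8, 7, 6, 5 or 4 bounds `n3 + 3 * n4 + 6 * n5 + 10 * n6 + 15 * n7 + 21 * n8` by
  -- 21, 15, 11, 9 or 9. The consequences are recorded separately to keep the case split small.
  have c8 : n8 ≤ 1 := by omega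
  have c7 : n7 ≤ 1 := by omega
  have c6 : n6 ≤ 1 := by omega
  have c5 : n5 ≤ 1 := by omega
  have m8 : n8 = 1 → n7 = 0 ∧ n6 = 0 ∧ n5 = 0 ∧ n4 = 0 ∧ n3 = 0 := by omega
  have m7 : n7 = 1 → n6 = 0 ∧ n5 = 0 ∧ n4 = 0 ∧ n3 = 0 := by omega
  have m6 : n6 = 1 → n5 = 0 ∧ n4 = 0 ∧ n3 ≤ 1 := by omega
  have m5 : n5 = 1 → n4 ≤ 1 ∧ n3 + 3 * n4 ≤ 3 := by omega
  have m4 : 1 ≤ n4 → n3 + 3 * n4 ≤ 9 := by omega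
  clear b8 b7 b6 b5 b4
  interval_cases n8 <;> interval_cases n7 <;> interval_cases n6 <;> interval_cases n5 <;>
    interval_cases n4 <;> try omega
  all_goals
    interval_cases n3 <;> try omega
  all_goals
    simp only [Nat.reduceMul, Nat.reduceEqDiff, Nat.add_zero, Nat.add_eq_right] at e1
    subst e1
    simp only [p0, add_zero, zero_add, Set.mem_insert_iff, Set.mem_singleton_iff, true_or, or_true]

/-! ### Uniqueness of the Möbius–Kantor configuration -/

/-- A system of collinear triples on eight points in which every point is joined to all others but
one is the Möbius–Kantor configuration. -/
theorem exists_moebiusKantor_labelling (col : Fin 8 → Fin 8 → Fin 8 → Prop) (opp : Fin 8 → Fin 8)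
    (col_ne : ∀ x y z, col x y z → x ≠ y ∧ x ≠ z ∧ y ≠ z)
    (col_swap : ∀ x y z, col x y z → col y x z)
    (col_rot : ∀ x y z, col x y z → col y z x)
    (col_unique : ∀ x y z w, col x y z → col x y w → z = w)
    (opp_ne : ∀ x, opp x ≠ x) (opp_opp : ∀ x, opp (opp x) = x)
    (not_col_opp : ∀ x y z, col x y z → y ≠ opp x)
    (exists_col : ∀ x y, y ≠ x → y ≠ opp x → ∃ z, col x y z) :
    ∃ p : Fin 8 → Fin 8, Function.Injective p ∧ ∀ i, col (p i) (p (i + 1)) (p (i + 3)) := by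
  obtain ⟨a, b, hb, hb'⟩ : ∃ a b : Fin 8, b ≠ a ∧ b ≠ opp a := by
    refine ⟨0, ?_⟩
    by_cases h : opp 0 = 1
    · exact ⟨2, by decide, by rw [h]; decide⟩
    · exact ⟨1, by decide, Ne.symm h⟩
  obtain ⟨d, hd⟩ := exists_col a b hb hb'
  have nodup6 : [a, b, d, opp a, opp b, opp d].Nodup := by
    have := col_ne _ _ _ hd
    simp only [List.nodup_cons, List.mem_cons, List.not_mem_nil, or_false, not_false_eq_true,
      List.nodup_nil, and_true]
    grind
  have nodup8 : ∀ c, c ∉ [a, b, d, opp a, opp b, opp d] →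
      [a, b, d, opp a, opp b, opp d, c, opp c].Nodup := by
    intro c hc
    simp only [List.nodup_cons, List.mem_cons, List.not_mem_nil, or_false, not_false_eq_true,
      List.nodup_nil, and_true, not_or] at nodup6 hc ⊢
    grind
  have cover : ∀ c, c ∉ [a, b, d, opp a, opp b, opp d] → ∀ z, z = a ∨ z = b ∨ z = d ∨ z = opp a ∨
      z = opp b ∨ z = opp d ∨ z = c ∨ z = opp c := by
    intro c hc z
    have h1 : [a, b, d, opp a, opp b, opp d, c, opp c].toFinset = Finset.univ := by
      rw [← Finset.card_eq_iff_eq_univ, List.toFinset_card_of_nodup (nodup8 c hc)]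
      simp
    have := Finset.mem_univ z
    rw [← h1] at this
    simpa using this
  -- The point `c` will receive label 2, from the block `{7, 0, 2}`. If the third point on `a` and
  -- `opp d` were `opp b`, only `y`, `opp y` and `opp a` would be left for further triples through
  -- `a`, and `a` and `y` could not be joined.
  have hc : ∃ c, col a (opp d) c ∧ c ∉ [a, b, d, opp a, opp b, opp d] := by
    simp only [List.nodup_cons, List.mem_cons, List.not_mem_nil, or_false, not_false_eq_true,
      List.nodup_nil, and_true, not_or] at nodup6
    obtain ⟨c, hc⟩ := exists_col a (opp d) (by grind) (by grind)
    by_cases hcb : c = opp b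
    · obtain ⟨y, hy⟩ : ∃ y, y ∉ [a, b, d, opp a, opp b, opp d] := by
        by_contra! hall
        have h1 : [a, b, d, opp a, opp b, opp d].toFinset = Finset.univ := by
          ext z
          simpa using hall z
        have h2 := List.toFinset_card_le [a, b, d, opp a, opp b, opp d]
        rw [h1] at h2
        simp at h2
      have hcov := cover y hy
      simp only [List.mem_cons, List.not_mem_nil, or_false, not_or] at hy
      obtain ⟨z, hz⟩ := exists_col a y (by grind) (by grind)
      rcases hcov z with rfl | rfl | rfl | rfl | rfl | rfl | rfl | rfl <;> grind
    · refine ⟨c, hc, ?_⟩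
      simp only [List.mem_cons, List.not_mem_nil, or_false, not_or]
      grind
  obtain ⟨c, hc, hmem⟩ := hc
  have nodup := nodup8 c hmem
  replace cover := cover c hmem
  -- The digits name the labels `a, b, c, d = 0, 1, 2, 3`, with `opp` adding 4. Each triple is
  -- forced: every other candidate for the third point is opposite to, or already joined to, one of
  -- the two given points.
  have h056 : col a (opp b) (opp c) := by
    simp only [List.nodup_cons, List.mem_cons, List.not_mem_nil, or_false, not_false_eq_true,
      List.nodup_nil, and_true, not_or] at nodup
    obtain ⟨z, hz⟩ := exists_col a (opp b) (by grind) (by grind)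
    rcases cover z with rfl | rfl | rfl | rfl | rfl | rfl | rfl | rfl <;> grind
  clear nodup6 nodup8 hmem
  simp only [List.nodup_cons, List.mem_cons, List.not_mem_nil, or_false, not_false_eq_true,
      List.nodup_nil, and_true, not_or] at nodup
  have h124 : col b c (opp a) := by
    obtain ⟨z, hz⟩ := exists_col b c (by grind) (by grind)
    obtain ⟨w, hw⟩ := exists_col b (opp a) (by grind) (by grind)
    rcases cover z with rfl | rfl | rfl | rfl | rfl | rfl | rfl | rfl <;> grind
  have h167 : col (opp c) (opp d) b := by
    obtain ⟨z, hz⟩ := exists_col b (opp c) (by grind) (by grind)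
    rcases cover z with rfl | rfl | rfl | rfl | rfl | rfl | rfl | rfl <;> grind
  have h235 : col c d (opp b) := by
    obtain ⟨z, hz⟩ := exists_col d c (by grind) (by grind)
    rcases cover z with rfl | rfl | rfl | rfl | rfl | rfl | rfl | rfl <;> grind
  have h346 : col d (opp a) (opp c) := by
    obtain ⟨z, hz⟩ := exists_col d (opp a) (by grind) (by grind)
    rcases cover z with rfl | rfl | rfl | rfl | rfl | rfl | rfl | rfl <;> grind
  have h457 : col (opp a) (opp b) (opp d) := by
    obtain ⟨z, hz⟩ := exists_col (opp a) (opp b) (by grind) (by grind)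
    rcases cover z with rfl | rfl | rfl | rfl | rfl | rfl | rfl | rfl <;> grind
  refine ⟨![a, b, c, d, opp a, opp b, opp c, opp d], ?_, ?_⟩
  · rw [← List.nodup_ofFn]
    change [a, b, c, d, opp a, opp b, opp c, opp d].Nodup
    simp only [List.nodup_cons, List.mem_cons, List.not_mem_nil, or_false, not_false_eq_true,
      List.nodup_nil, and_true, not_or]
    grind
  · intro i
    fin_cases i
    · exact hd
    · exact h124
    · exact h235
    · exact h346
    · exact h457
    · exact col_rot _ _ _ h056
    · exact h167
    · exact col_swap _ _ _ hc

/-- In a linear space on eight points with four blocks of size two and eight of size three, the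
blocks of size three form the Möbius–Kantor configuration. -/
theorem IsLinearSpace.exists_moebiusKantor_labelling {𝓑 : Finset (Finset (Fin 8))}
    (h : IsLinearSpace 𝓑) (hs : blockSignature 𝓑 = pts 2 4 + pts 3 8) :
    ∃ p : Fin 8 → Fin 8, Function.Injective p ∧
      ∀ i, ({p i, p (i + 1), p (i + 3)} : Finset (Fin 8)) ∈ 𝓑 := by
  have hcard : ∀ B ∈ 𝓑, B.card = 2 ∨ B.card = 3 := by
    intro B hB
    by_contra! hc
    have h1 : blockSignature 𝓑 B.card = 0 := by simp [hs, pts, hc]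
    rw [blockSignature, Finset.card_eq_zero, Finset.filter_eq_empty_iff] at h1
    exact h1 hB rfl
  have h2 : (𝓑.filter fun B => B.card = 2).card = 4 := by
    simpa [pts, blockSignature] using congrFun hs 2
  -- Parity: if only triples passed through `x`, they would partition seven points into pairs.
  have hone : ∀ x, 1 ≤ (𝓑.filter fun B => B.card = 2 ∧ x ∈ B).card := by
    intro x
    by_contra! hc
    rw [Nat.lt_one_iff, Finset.card_eq_zero, Finset.filter_eq_empty_iff] at hc
    have h3 := h.sum_card_sub_one x
    rw [Finset.sum_congr rfl (g := fun _ => 2), Finset.sum_const, Fintype.card_fin] at h3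
    · simp only [smul_eq_mul] at h3
      omega
    · intro B hB
      rw [Finset.mem_filter] at hB
      rcases hcard B hB.1 with h4 | h4
      · exact absurd ⟨h4, hB.2⟩ (hc hB.1)
      · rw [h4]
  -- Four pairs give eight incidences, so the lower bound 1 is attained at each of the eight points:
  -- the pairs form a perfect matching, which defines `opp`.
  have hone' : ∀ x, (𝓑.filter fun B => B.card = 2 ∧ x ∈ B).card = 1 := by
    have h3 := IsLinearSpace.sum_card_filter_mem 𝓑 2
    rw [h2] at h3
    have h4 : ∑ x : Fin 8, 1 = ∑ x, (𝓑.filter fun B => B.card = 2 ∧ x ∈ B).card := by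
      rw [h3]; simp
    rw [Finset.sum_eq_sum_iff_of_le fun x _ => hone x] at h4
    exact fun x => (h4 x (Finset.mem_univ x)).symm
  have hopp : ∀ x, ∃ y, y ≠ x ∧ ({x, y} : Finset (Fin 8)) ∈ 𝓑 := by
    intro x
    obtain ⟨B, hB⟩ := Finset.card_pos.1 (hone x)
    obtain ⟨hB, hB2, hx⟩ := Finset.mem_filter.1 hB
    obtain ⟨u, v, huv, rfl⟩ := Finset.card_eq_two.1 hB2
    simp only [Finset.mem_insert, Finset.mem_singleton] at hx
    rcases hx with rfl | rfl
    · exact ⟨v, huv.symm, hB⟩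
    · exact ⟨u, huv, by rwa [Finset.pair_comm]⟩
  choose opp opp_ne opp_mem using hopp
  have opp_unique : ∀ x y, y ≠ x → ({x, y} : Finset (Fin 8)) ∈ 𝓑 → y = opp x := by
    intro x y hy hB
    have h3 := (Finset.card_le_one.1 (hone' x).le) {x, y}
      (Finset.mem_filter.2 ⟨hB, Finset.card_pair hy.symm, by simp⟩) {x, opp x}
      (Finset.mem_filter.2 ⟨opp_mem x, Finset.card_pair (opp_ne x).symm, by simp⟩)
    have h4 : y ∈ ({x, opp x} : Finset (Fin 8)) := by rw [← h3]; simp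
    simpa [hy] using h4
  obtain ⟨p, hp, hcol⟩ := _root_.exists_moebiusKantor_labelling
    (fun x y z => ({x, y, z} : Finset (Fin 8)) ∈ 𝓑 ∧ x ≠ y ∧ x ≠ z ∧ y ≠ z) opp
    (fun x y z hc => hc.2)
    (fun x y z hc => ⟨by rw [Finset.insert_comm]; exact hc.1, hc.2.1.symm, hc.2.2.2, hc.2.2.1⟩)
    (fun x y z hc => ⟨by
      have : ({y, z, x} : Finset (Fin 8)) = {x, y, z} := by ext; simp; tauto
      rw [this]; exact hc.1, hc.2.2.2, hc.2.1.symm, hc.2.2.1.symm⟩)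
    (fun x y z w hz hw => by
      have h3 := h.eq_block _ hz.1 _ hw.1 x y hz.2.1 (by simp) (by simp) (by simp) (by simp)
      have h4 : z ∈ ({x, y, w} : Finset (Fin 8)) := by rw [← h3]; simp
      simpa [hz.2.2.1.symm, hz.2.2.2.symm] using h4)
    opp_ne
    (fun x => (opp_unique (opp x) x (opp_ne x).symm (by
      rw [Finset.pair_comm]; exact opp_mem x)).symm)
    (fun x y z hc hy => by
      subst hy
      have h3 := h.eq_block _ hc.1 _ (opp_mem x) x (opp x) hc.2.1 (by simp) (by simp) (by simp)
        (by simp)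
      have h4 : z ∈ ({x, opp x} : Finset (Fin 8)) := by rw [← h3]; simp
      simp only [Finset.mem_insert, Finset.mem_singleton] at h4
      exact h4.elim (Ne.symm hc.2.2.1) (Ne.symm hc.2.2.2))
    (fun x y hx hy => by
      obtain ⟨B, hB, hxB, hyB⟩ := h.exists_block x y hx.symm
      rcases hcard B hB with h3 | h3
      · refine absurd (opp_unique x y hx ?_) hy
        rwa [← Finset.eq_of_subset_of_card_le (s := {x, y}) (t := B)
          (by simp [Finset.insert_subset_iff, hxB, hyB]) (by rw [h3, Finset.card_pair hx.symm])]
          at hB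
      · obtain ⟨z, hz⟩ : ∃ z, z ∈ (B.erase x).erase y := by
          apply Finset.card_pos.1
          rw [Finset.card_erase_of_mem (Finset.mem_erase.2 ⟨hx, hyB⟩), Finset.card_erase_of_mem hxB]
          omega
        simp only [Finset.mem_erase] at hz
        refine ⟨z, ?_, hx.symm, hz.2.1.symm, hz.1.symm⟩
        have hsub : ({x, y, z} : Finset (Fin 8)) = B := Finset.eq_of_subset_of_card_le
          (by simp [Finset.insert_subset_iff, hxB, hyB, hz.2.2])
          (by rw [h3, Finset.card_eq_three.2 ⟨x, y, z, hx.symm, hz.2.1.symm, hz.1.symm, rfl⟩])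
        rwa [hsub])
  exact ⟨p, hp, fun i => (hcol i).1⟩

/-! ### Sign argument against the Möbius–Kantor configuration -/

/-- The determinants of triples of the lines of an arrangement of pseudolines, up to positive
factors that may depend on the first line: the three-term Grassmann–Plücker relations hold for a
fixed first line, and the signs are alternating. -/
structure IsSignDeterminant {ι : Type*} (f : ι → ι → ι → ℝ) : Prop where
  swap : ∀ a b c, f a c b = -f a b c
  rotate : ∀ a b c, f b c a < 0 ↔ f a b c < 0
  plucker : ∀ a b c d e, f a b c * f a d e - f a b d * f a c e + f a b e * f a c d = 0

/-- The sign of a nonzero real number, as an element of `ZMod 2`. -/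
noncomputable def signBit (x : ℝ) : ZMod 2 := if x < 0 then 1 else 0

theorem signBit_neg {x : ℝ} (hx : x ≠ 0) : signBit (-x) = signBit x + 1 := by
  rcases hx.lt_or_gt with h | h
  · simp only [signBit, h, if_true, Left.neg_neg_iff, not_lt.2 h.le, if_false]
    decide
  · simp [signBit, h, not_lt.2 h.le]

theorem signBit_mul {x y : ℝ} (hx : x ≠ 0) (hy : y ≠ 0) :
    signBit (x * y) = signBit x + signBit y := by
  rcases hx.lt_or_gt with h | h <;> rcases hy.lt_or_gt with h' | h'
  · simp only [signBit, h, h', if_true, not_lt.2 (mul_pos_of_neg_of_neg h h').le, if_false]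
    decide
  · simp [signBit, h, mul_neg_of_neg_of_pos h h', not_lt.2 h'.le]
  · simp [signBit, h', mul_neg_of_pos_of_neg h h', not_lt.2 h.le]
  · simp [signBit, not_lt.2 (mul_pos h h').le, not_lt.2 h'.le, not_lt.2 h.le]

theorem neg_iff_of_signBit_eq {x y : ℝ} (h : signBit x = signBit y) : x < 0 ↔ y < 0 := by
  unfold signBit at h
  split_ifs at h with hx hy hy
  · exact iff_of_true hx hy
  · exact absurd h one_ne_zero
  · exact absurd h zero_ne_one
  · exact iff_of_false hx hy

/-- The blocks of the Möbius–Kantor configuration are the translates of `{0, 1, 3}`. -/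
def IsMoebiusKantorBlock (i j k : Fin 8) : Prop :=
  ∃ m, ({i, j, k} : Finset (Fin 8)) = {m, m + 1, m + 3}

/-- Three distinct points that are not a block of the Möbius–Kantor configuration. -/
def IsMoebiusKantorBasis (i j k : Fin 8) : Prop :=
  (i ≠ j ∧ i ≠ k ∧ j ≠ k) ∧ ¬ IsMoebiusKantorBlock i j k

instance (i j k : Fin 8) : Decidable (IsMoebiusKantorBlock i j k) := by
  unfold IsMoebiusKantorBlock; infer_instance

instance (i j k : Fin 8) : Decidable (IsMoebiusKantorBasis i j k) := by
  unfold IsMoebiusKantorBasis; infer_instance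

/-- The sign bits of the bases of an oriented Möbius–Kantor configuration. -/
structure IsMoebiusKantorOrientation (g : Fin 8 → Fin 8 → Fin 8 → ZMod 2) : Prop where
  s120 : ∀ i j k, IsMoebiusKantorBasis i j k → g j k i = g i j k
  s201 : ∀ i j k, IsMoebiusKantorBasis i j k → g k i j = g i j k
  s021 : ∀ i j k, IsMoebiusKantorBasis i j k → g i k j = g i j k + 1
  s102 : ∀ i j k, IsMoebiusKantorBasis i j k → g j i k = g i j k + 1
  s210 : ∀ i j k, IsMoebiusKantorBasis i j k → g k j i = g i j k + 1
  -- The Plücker relation at `i` with `f i j k = 0`: the two surviving products are equal.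
  key : ∀ i j k l m, (i ≠ j ∧ i ≠ k ∧ j ≠ k) ∧ IsMoebiusKantorBlock i j k →
    IsMoebiusKantorBasis i j l ∧ IsMoebiusKantorBasis i k m ∧ IsMoebiusKantorBasis i j m ∧
      IsMoebiusKantorBasis i k l → g i j l + g i k m = g i j m + g i k l

/-- Summing one `key` relation from each of the eight blocks cancels all other sign bits modulo 2.
The rewrites sort the indices, and the parity of these permutations produces the final 1. -/
theorem IsMoebiusKantorOrientation.add_eq_add_add_one {g : Fin 8 → Fin 8 → Fin 8 → ZMod 2}
    (h : IsMoebiusKantorOrientation g) : g 0 1 2 + g 0 4 5 = g 0 1 4 + g 0 2 5 + 1 := by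
  have k1 := h.key 3 2 5 1 4 (by decide) (by decide)
  rw [h.s210 1 2 3 (by decide), h.s021 3 4 5 (by decide), h.s102 2 3 4 (by decide),
    h.s120 1 3 5 (by decide)] at k1
  have k2 := h.key 0 2 7 4 6 (by decide) (by decide)
  rw [h.s021 0 6 7 (by decide), h.s021 0 4 7 (by decide)] at k2
  have k3 := h.key 0 5 6 1 2 (by decide) (by decide)
  rw [h.s021 0 1 5 (by decide), h.s021 0 2 6 (by decide), h.s021 0 2 5 (by decide),
    h.s021 0 1 6 (by decide)] at k3
  have k4 := h.key 2 1 4 0 3 (by decide) (by decide)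
  rw [h.s210 0 1 2 (by decide), h.s021 2 3 4 (by decide), h.s102 1 2 3 (by decide),
    h.s120 0 2 4 (by decide)] at k4
  have k5 := h.key 4 5 7 0 6 (by decide) (by decide)
  rw [h.s120 0 4 5 (by decide), h.s021 4 6 7 (by decide), h.s120 0 4 7 (by decide)] at k5
  have k6 := h.key 6 1 7 0 4 (by decide) (by decide)
  rw [h.s210 0 1 6 (by decide), h.s120 4 6 7 (by decide), h.s201 1 4 6 (by decide),
    h.s120 0 6 7 (by decide)] at k6
  have k7 := h.key 1 0 3 4 5 (by decide) (by decide)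
  rw [h.s102 0 1 4 (by decide), h.s102 0 1 5 (by decide)] at k7
  have k8 := h.key 4 3 6 1 5 (by decide) (by decide)
  rw [h.s210 1 3 4 (by decide), h.s021 4 5 6 (by decide), h.s102 3 4 5 (by decide),
    h.s120 1 4 6 (by decide)] at k8
  have two : (2 : ZMod 2) = 0 := by decide
  linear_combination k1 + k2 + k3 + k4 + k5 + k6 + k7 + k8 + ((-3) + (1) * g 0 4 7 +
    (-1) * g 4 6 7 + (1) * g 1 4 6 + (-1) * g 0 1 4) * two

/-- Again one `key` relation per block, but with other base points and auxiliary indices, chosen to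
reach the third product of the same Plücker relation. -/
theorem IsMoebiusKantorOrientation.add_eq_add {g : Fin 8 → Fin 8 → Fin 8 → ZMod 2}
    (h : IsMoebiusKantorOrientation g) : g 0 1 2 + g 0 4 5 = g 0 1 5 + g 0 2 4 := by
  have k1 := h.key 3 4 6 1 2 (by decide) (by decide)
  rw [h.s120 1 3 4 (by decide), h.s120 2 3 6 (by decide), h.s120 2 3 4 (by decide),
    h.s120 1 3 6 (by decide)] at k1
  have k2 := h.key 5 0 6 1 2 (by decide) (by decide)
  rw [h.s201 0 1 5 (by decide), h.s120 2 5 6 (by decide), h.s201 0 2 5 (by decide),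
    h.s120 1 5 6 (by decide)] at k2
  have k3 := h.key 4 1 2 0 5 (by decide) (by decide)
  rw [h.s210 0 1 4 (by decide), h.s102 2 4 5 (by decide), h.s102 1 4 5 (by decide),
    h.s210 0 2 4 (by decide)] at k3
  have k4 := h.key 1 6 7 0 5 (by decide) (by decide)
  rw [h.s120 0 1 6 (by decide), h.s021 1 5 7 (by decide), h.s021 1 5 6 (by decide),
    h.s120 0 1 7 (by decide)] at k4
  have k5 := h.key 2 3 5 4 6 (by decide) (by decide)
  rw [h.s021 2 4 5 (by decide)] at k5
  have k6 := h.key 1 0 3 4 6 (by decide) (by decide)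
  rw [h.s102 0 1 4 (by decide), h.s102 0 1 6 (by decide)] at k6
  have k7 := h.key 0 2 7 1 5 (by decide) (by decide)
  rw [h.s021 0 1 2 (by decide), h.s021 0 5 7 (by decide), h.s021 0 1 7 (by decide)] at k7
  have k8 := h.key 5 4 7 0 1 (by decide) (by decide)
  rw [h.s210 0 4 5 (by decide), h.s120 1 5 7 (by decide), h.s210 1 4 5 (by decide),
    h.s120 0 5 7 (by decide)] at k8
  have two : (2 : ZMod 2) = 0 := by decide
  linear_combination k1 + k2 + k3 + k4 + k5 + k6 + k7 + k8 + ((-1) * g 0 1 5 + (-1) * g 2 5 6 +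
    (1) * g 0 2 5 + (1) * g 1 5 6 + (-1) * g 0 1 4 + (1) * g 1 4 5 + (-1) * g 1 5 7 +
    (1) * g 0 1 7) * two

/-- The Möbius–Kantor configuration is not realizable by pseudolines. -/
theorem IsSignDeterminant.not_moebiusKantor {f : Fin 8 → Fin 8 → Fin 8 → ℝ}
    (hf : IsSignDeterminant f)
    (hzero : ∀ i j k, i ≠ j ∧ i ≠ k ∧ j ≠ k → (f i j k = 0 ↔ IsMoebiusKantorBlock i j k)) :
    False := by
  have ne : ∀ i j k, IsMoebiusKantorBasis i j k → f i j k ≠ 0 :=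
    fun i j k h => (hzero i j k h.1).not.2 h.2
  have s120 : ∀ i j k, signBit (f j k i) = signBit (f i j k) := by
    intro i j k
    simp only [signBit, hf.rotate i j k]
  have s021 : ∀ i j k, IsMoebiusKantorBasis i j k →
      signBit (f i k j) = signBit (f i j k) + 1 := by
    intro i j k h
    rw [hf.swap i j k, signBit_neg (ne i j k h)]
  have horient : IsMoebiusKantorOrientation fun i j k => signBit (f i j k) :=
    { s120 := fun i j k _ => s120 i j k
      s201 := fun i j k _ => (s120 k i j).symm
      s021 := s021
      s102 := fun i j k h => by
        rw [← s120 j i k]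
        exact s021 i j k h
      s210 := fun i j k h => by
        rw [s120 i k j]
        exact s021 i j k h
      key := fun i j k l m h0 h => by
        have h1 := hf.plucker i j k l m
        rw [(hzero i j k h0.1).2 h0.2, zero_mul, zero_sub, neg_add_eq_zero] at h1
        rw [← signBit_mul (ne _ _ _ h.1) (ne _ _ _ h.2.1), h1,
          signBit_mul (ne _ _ _ h.2.2.1) (ne _ _ _ h.2.2.2)] }
  have h1 := horient.add_eq_add_add_one
  have h2 := horient.add_eq_add
  -- In `f 0 1 2 * f 0 4 5 - f 0 1 4 * f 0 2 5 + f 0 1 5 * f 0 2 4 = 0` the second product has the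
  -- sign opposite to the first, and the third has the same sign, so all three signed terms agree in
  -- sign.
  have h3 := hf.plucker 0 1 2 4 5
  have h012 := ne 0 1 2 (by decide)
  have h045 := ne 0 4 5 (by decide)
  have h014 := ne 0 1 4 (by decide)
  have h025 := ne 0 2 5 (by decide)
  have h015 := ne 0 1 5 (by decide)
  have h024 := ne 0 2 4 (by decide)
  rw [← signBit_mul h012 h045, ← signBit_mul h014 h025,
    ← signBit_neg (mul_ne_zero h014 h025)] at h1
  rw [← signBit_mul h012 h045, ← signBit_mul h015 h024] at h2
  have h6 := neg_iff_of_signBit_eq h1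
  have h7 := neg_iff_of_signBit_eq h2
  rcases (mul_ne_zero h012 h045).lt_or_gt with h | h
  · linarith [h6.1 h, h7.1 h]
  · linarith [not_lt.1 (h6.not.1 h.le.not_gt), not_lt.1 (h7.not.1 h.le.not_gt)]

/-- An arrangement of eight pseudolines does not have the signature `[2^4 3^8]`. -/
theorem IsLinearSpace.blockSignature_ne {𝓑 : Finset (Finset (Fin 8))} (h : IsLinearSpace 𝓑)
    {f : Fin 8 → Fin 8 → Fin 8 → ℝ} (hf : IsSignDeterminant f)
    (hzero : ∀ x y z, x ≠ y ∧ x ≠ z ∧ y ≠ z →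
      (f x y z = 0 ↔ ∃ B ∈ 𝓑, x ∈ B ∧ y ∈ B ∧ z ∈ B)) :
    blockSignature 𝓑 ≠ pts 2 4 + pts 3 8 := by
  intro hs
  obtain ⟨p, hp, hblock⟩ := h.exists_moebiusKantor_labelling hs
  have hf' : IsSignDeterminant fun i j k => f (p i) (p j) (p k) :=
    ⟨fun _ _ _ => hf.swap _ _ _, fun _ _ _ => hf.rotate _ _ _,
      fun _ _ _ _ _ => hf.plucker _ _ _ _ _⟩
  refine hf'.not_moebiusKantor fun i j k hd => ?_
  rw [hzero _ _ _ ⟨hp.ne hd.1, hp.ne hd.2.1, hp.ne hd.2.2⟩]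
  have hmem : ∀ m i, p i ∈ ({p m, p (m + 1), p (m + 3)} : Finset (Fin 8)) ↔
      i ∈ ({m, m + 1, m + 3} : Finset (Fin 8)) := by
    intro m i
    simp [hp.eq_iff]
  constructor
  · rintro ⟨B, hB, hi, hj, hk⟩
    -- The pairs not joined by a block are `{m, m + 4}`; they are disjoint, so among three points
    -- some two are joined. This identifies `B` with a known triple.
    have hpair : ∀ i j k : Fin 8, i ≠ j ∧ i ≠ k ∧ j ≠ k → ∃ m,
        (i ∈ ({m, m + 1, m + 3} : Finset (Fin 8)) ∧ j ∈ ({m, m + 1, m + 3} : Finset (Fin 8))) ∨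
        (i ∈ ({m, m + 1, m + 3} : Finset (Fin 8)) ∧ k ∈ ({m, m + 1, m + 3} : Finset (Fin 8))) ∨
        (j ∈ ({m, m + 1, m + 3} : Finset (Fin 8)) ∧ k ∈ ({m, m + 1, m + 3} : Finset (Fin 8))) := by
      decide
    obtain ⟨m, hm⟩ := hpair i j k hd
    have hBm : B = {p m, p (m + 1), p (m + 3)} := by
      rcases hm with hm | hm | hm
      · exact h.eq_block _ hB _ (hblock m) (p i) (p j) (hp.ne hd.1) hi hj ((hmem _ _).2 hm.1)
          ((hmem _ _).2 hm.2)
      · exact h.eq_block _ hB _ (hblock m) (p i) (p k) (hp.ne hd.2.1) hi hk ((hmem _ _).2 hm.1)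
          ((hmem _ _).2 hm.2)
      · exact h.eq_block _ hB _ (hblock m) (p j) (p k) (hp.ne hd.2.2) hj hk ((hmem _ _).2 hm.1)
          ((hmem _ _).2 hm.2)
    subst hBm
    rw [hmem] at hi hj hk
    refine ⟨m, Finset.eq_of_subset_of_card_le (by
      rw [Finset.insert_subset_iff, Finset.insert_subset_iff, Finset.singleton_subset_iff]
      exact ⟨hi, hj, hk⟩) ?_⟩
    rw [Finset.card_eq_three.2 ⟨i, j, k, hd.1, hd.2.1, hd.2.2, rfl⟩]
    exact Finset.card_le_three
  · rintro ⟨m, hm⟩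
    refine ⟨_, hblock m, ?_⟩
    rw [hmem, hmem, hmem, ← hm]
    simp

/-! ### Lines of the real plane and their linear space -/

/-- A line of the plane with its equation `a x + b y = c`. -/
structure LineEquation (R : Type*) where
  a : R
  b : R
  c : R

namespace LineEquation

/-- The determinant of the normal vectors of two lines. -/
def normalDet {R : Type*} [CommRing R] (l m : LineEquation R) : R := l.a * m.b - l.b * m.a

/-- The determinant of the equations of three lines. -/
def det {R : Type*} [CommRing R] (l m n : LineEquation R) : R :=
  l.a * (m.b * n.c - m.c * n.b) - l.b * (m.a * n.c - m.c * n.a) + l.c * (m.a * n.b - m.b * n.a)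

/-- The set of points of a line. -/
def points (l : LineEquation ℝ) : Set (ℝ × ℝ) := {P | l.a * P.1 + l.b * P.2 = l.c}

/-- The intersection point of two lines. -/
noncomputable def inter (l m : LineEquation ℝ) : ℝ × ℝ :=
  ((l.c * m.b - l.b * m.c) / normalDet l m, (l.a * m.c - l.c * m.a) / normalDet l m)

theorem inter_mem_left {l m : LineEquation ℝ} (h : normalDet l m ≠ 0) : inter l m ∈ l.points := by
  simp only [points, inter, Set.mem_ofPred_eq]
  field_simp
  unfold normalDet
  ring

theorem inter_mem_right {l m : LineEquation ℝ} (h : normalDet l m ≠ 0) : inter l m ∈ m.points := by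
  simp only [points, inter, Set.mem_ofPred_eq]
  field_simp
  unfold normalDet
  ring

theorem eq_inter {l m : LineEquation ℝ} (h : normalDet l m ≠ 0) {P : ℝ × ℝ} (hl : P ∈ l.points)
    (hm : P ∈ m.points) : P = inter l m := by
  simp only [points, Set.mem_ofPred_eq] at hl hm
  refine Prod.ext ?_ ?_
  · simp only [inter]
    rw [eq_div_iff h, normalDet]
    linear_combination m.b * hl - l.b * hm
  · simp only [inter]
    rw [eq_div_iff h, normalDet]
    linear_combination l.a * hm - m.a * hl

/-- The determinant is `normalDet l m` times the error of the point `inter l m` in the equation of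
`n`. -/
theorem inter_mem_iff {l m n : LineEquation ℝ} (h : normalDet l m ≠ 0) :
    inter l m ∈ n.points ↔ det l m n = 0 := by
  have h3 : det l m n = normalDet l m * (n.c - (n.a * (inter l m).1 + n.b * (inter l m).2)) := by
    simp only [inter]
    field_simp
    unfold det normalDet
    ring
  rw [h3, mul_eq_zero, or_iff_right h, sub_eq_zero, eq_comm, points, Set.mem_ofPred_eq]

theorem points_eq_of_normalDet_eq_zero {l m : LineEquation ℝ} (hl : l.a ≠ 0 ∨ l.b ≠ 0)
    (hm : m.a ≠ 0 ∨ m.b ≠ 0) (h : normalDet l m = 0) {P : ℝ × ℝ} (hPl : P ∈ l.points)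
    (hPm : P ∈ m.points) : l.points = m.points := by
  have key : ∀ {l m : LineEquation ℝ}, (l.a ≠ 0 ∨ l.b ≠ 0) → normalDet l m = 0 →
      P ∈ l.points → P ∈ m.points → l.points ⊆ m.points := by
    intro l m hl h hPl hPm Q hQ
    simp only [points, Set.mem_ofPred_eq, normalDet] at *
    rcases hl with ha | hb
    · apply mul_left_cancel₀ ha
      linear_combination m.a * hQ - m.a * hPl + l.a * hPm + (Q.2 - P.2) * h
    · apply mul_left_cancel₀ hb
      linear_combination m.b * hQ - m.b * hPl + l.b * hPm - (Q.1 - P.1) * h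
  refine (key hl h hPl hPm).antisymm (key hm ?_ hPm hPl)
  unfold normalDet at *
  linear_combination -h

end LineEquation

/-- The sets of lines through the intersection points of the lines with given equations. -/
def lineBlocks {R : Type*} [CommRing R] [DecidableEq R] (e : Fin 8 → LineEquation R) :
    Finset (Finset (Fin 8)) :=
  (Finset.univ.offDiag : Finset (Fin 8 × Fin 8)).image fun q =>
    Finset.univ.filter fun k => LineEquation.det (e q.1) (e q.2) (e k) = 0

open Classical in
theorem mem_lineBlocks {e : Fin 8 → LineEquation ℝ}
    (he : ∀ i j, i ≠ j → LineEquation.normalDet (e i) (e j) ≠ 0) (B : Finset (Fin 8)) :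
    B ∈ lineBlocks e ↔ 2 ≤ B.card ∧ ∃ P, ∀ k, k ∈ B ↔ P ∈ (e k).points := by
  simp only [lineBlocks, Finset.mem_image, Finset.mem_offDiag, Finset.mem_univ, true_and,
    ne_eq]
  constructor
  · rintro ⟨⟨i, j⟩, hij, rfl⟩
    have hmem : ∀ k, k ∈ (Finset.univ.filter fun k => LineEquation.det (e i) (e j) (e k) = 0) ↔
        LineEquation.inter (e i) (e j) ∈ (e k).points := fun k => by
      simp [LineEquation.inter_mem_iff (he i j hij)]
    refine ⟨?_, _, hmem⟩
    refine Finset.one_lt_card.2 ⟨i, (hmem i).2 ?_, j, (hmem j).2 ?_, hij⟩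
    · exact LineEquation.inter_mem_left (he i j hij)
    · exact LineEquation.inter_mem_right (he i j hij)
  · rintro ⟨h2, P, hP⟩
    obtain ⟨i, hi, j, hj, hij⟩ := Finset.one_lt_card.1 h2
    refine ⟨(i, j), hij, ?_⟩
    ext k
    rw [hP, LineEquation.eq_inter (he i j hij) ((hP i).1 hi) ((hP j).1 hj),
      LineEquation.inter_mem_iff (he i j hij)]
    simp

open Classical in
theorem isLinearSpace_lineBlocks {e : Fin 8 → LineEquation ℝ}
    (he : ∀ i j, i ≠ j → LineEquation.normalDet (e i) (e j) ≠ 0) :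
    IsLinearSpace (lineBlocks e) where
  two_le B hB := ((mem_lineBlocks he B).1 hB).1
  exists_block x y hxy := by
    refine ⟨_, Finset.mem_image_of_mem _ (a := (x, y)) (by simp [hxy]), ?_⟩
    simp only [Finset.mem_filter, Finset.mem_univ, true_and,
      ← LineEquation.inter_mem_iff (he x y hxy)]
    exact ⟨LineEquation.inter_mem_left (he x y hxy), LineEquation.inter_mem_right (he x y hxy)⟩
  eq_block B hB C hC x y hxy hxB hyB hxC hyC := by
    obtain ⟨-, P, hP⟩ := (mem_lineBlocks he B).1 hB
    obtain ⟨-, Q, hQ⟩ := (mem_lineBlocks he C).1 hC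
    have hPQ : P = Q := (LineEquation.eq_inter (he x y hxy) ((hP x).1 hxB) ((hP y).1 hyB)).trans
      (LineEquation.eq_inter (he x y hxy) ((hQ x).1 hxC) ((hQ y).1 hyC)).symm
    ext k
    rw [hP, hQ, hPQ]

open Classical in
theorem RealLineArrangement.signature_eq_blockSignature (A : RealLineArrangement 8)
    {e : Fin 8 → LineEquation ℝ} (hA : ∀ i, A.line i = (e i).points)
    (he : ∀ i j, i ≠ j → LineEquation.normalDet (e i) (e j) ≠ 0) :
    A.signature = blockSignature (lineBlocks e) := by
  funext k
  unfold RealLineArrangement.signature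
  split_ifs with hk
  · have hmult : ∀ P, A.multiplicity P = (Finset.univ.filter fun i => P ∈ A.line i).card := by
      intro P
      rw [RealLineArrangement.multiplicity, ← Set.ncard_coe_finset]
      congr 1
      ext i
      simp
    rw [blockSignature, ← Set.ncard_coe_finset]
    -- A point corresponds to the set of lines through it; since `k ≥ 2`, two of these lines recover
    -- the point.
    refine Set.ncard_congr (fun P _ => Finset.univ.filter fun i => P ∈ A.line i) ?_ ?_ ?_
    · intro P hP
      rw [Set.mem_ofPred_eq, hmult] at hP
      rw [Finset.mem_coe, Finset.mem_filter, mem_lineBlocks he]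
      exact ⟨⟨by omega, P, fun i => by simp [hA]⟩, hP⟩
    · intro P Q hP hQ hPQ
      rw [Set.mem_ofPred_eq, hmult] at hP
      obtain ⟨i, hi, j, hj, hij⟩ := Finset.one_lt_card.1 (show 1 < _ by rw [hP]; omega)
      have hi' := hPQ ▸ hi
      have hj' := hPQ ▸ hj
      simp only [Finset.mem_filter, Finset.mem_univ, true_and, hA] at hi hj hi' hj'
      exact (LineEquation.eq_inter (he i j hij) hi hj).trans
        (LineEquation.eq_inter (he i j hij) hi' hj').symm
    · intro B hB
      rw [Finset.mem_coe, Finset.mem_filter, mem_lineBlocks he] at hB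
      obtain ⟨⟨-, P, hP⟩, hB⟩ := hB
      have hPB : (Finset.univ.filter fun i => P ∈ A.line i) = B := by
        ext i
        simp [hP, hA]
      exact ⟨P, by rw [Set.mem_ofPred_eq, hmult, hPB, hB], hPB⟩
  · refine (Finset.card_eq_zero.2 (Finset.filter_eq_empty_iff.2 fun B hB hc => ?_)).symm
    have := (isLinearSpace_lineBlocks he).two_le B hB
    omega

theorem isSignDeterminant_det {ι : Type*} (e : ι → LineEquation ℝ) :
    IsSignDeterminant fun i j k => LineEquation.det (e i) (e j) (e k) where
  swap i j k := by unfold LineEquation.det; ring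
  rotate i j k := by
    have : LineEquation.det (e j) (e k) (e i) = LineEquation.det (e i) (e j) (e k) := by
      unfold LineEquation.det; ring
    rw [this]
  plucker a b c d e := by unfold LineEquation.det; ring

theorem RealLineArrangement.exists_equations (A : RealLineArrangement 8)
    (h : A.PairwiseMeeting) : ∃ e : Fin 8 → LineEquation ℝ, (∀ i, A.line i = (e i).points) ∧
      ∀ i j, i ≠ j → LineEquation.normalDet (e i) (e j) ≠ 0 := by
  choose a b c hab hline using A.isLine
  refine ⟨fun i => ⟨a i, b i, c i⟩, hline, fun i j hij h0 => hij (A.distinct ?_)⟩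
  obtain ⟨P, hPi, hPj⟩ := h i j
  rw [hline] at hPi hPj ⊢
  rw [hline j]
  exact LineEquation.points_eq_of_normalDet_eq_zero (l := ⟨a i, b i, c i⟩) (m := ⟨a j, b j, c j⟩)
    (hab i) (hab j) h0 hPi hPj

open Classical in
/-- The signature of a real arrangement is that of a linear space other than `[2^4 3^8]`. -/
theorem RealLineArrangement.exists_isLinearSpace (A : RealLineArrangement 8)
    (h : A.PairwiseMeeting) : ∃ 𝓑, IsLinearSpace 𝓑 ∧ A.signature = blockSignature 𝓑 ∧
      blockSignature 𝓑 ≠ pts 2 4 + pts 3 8 := by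
  obtain ⟨e, hA, he⟩ := A.exists_equations h
  refine ⟨lineBlocks e, isLinearSpace_lineBlocks he, A.signature_eq_blockSignature hA he, ?_⟩
  refine (isLinearSpace_lineBlocks he).blockSignature_ne (isSignDeterminant_det e) ?_
  rintro x y z ⟨hxy, -, -⟩
  constructor
  · intro h0
    refine ⟨_, Finset.mem_image_of_mem _ (a := (x, y)) (by simp [hxy]), ?_⟩
    simp only [Finset.mem_filter, Finset.mem_univ, true_and,
      ← LineEquation.inter_mem_iff (he x y hxy)] at h0 ⊢
    exact ⟨LineEquation.inter_mem_left (he x y hxy), LineEquation.inter_mem_right (he x y hxy), h0⟩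
  · rintro ⟨B, hB, hx, hy, hz⟩
    obtain ⟨-, P, hP⟩ := (mem_lineBlocks he B).1 hB
    rw [← LineEquation.inter_mem_iff (he x y hxy),
      ← LineEquation.eq_inter (he x y hxy) ((hP x).1 hx) ((hP y).1 hy)]
    exact (hP z).1 hz

/-! ### Wiring diagrams -/

namespace LefschetzPair

variable {ℓ : ℕ} (p : LefschetzPair ℓ)

theorem val_move_of_through {x : Fin ℓ} (h : p.Through x) :
    (p.move x : ℕ) = (p.first : ℕ) + (p.last : ℕ) - (x : ℕ) := by
  rw [move, dif_pos h]

theorem move_of_not_through {x : Fin ℓ} (h : ¬ p.Through x) : p.move x = x := by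
  rw [move, dif_neg h]

theorem through_move {x : Fin ℓ} (h : p.Through x) : p.Through (p.move x) := by
  have h1 := p.val_move_of_through h
  simp only [Through, Fin.le_def] at *
  omega

theorem move_move (x : Fin ℓ) : p.move (p.move x) = x := by
  by_cases h : p.Through x
  · have h1 := p.val_move_of_through h
    have h2 := p.val_move_of_through (p.through_move h)
    simp only [Through, Fin.le_def] at h
    rw [Fin.ext_iff]
    omega
  · rw [p.move_of_not_through h, p.move_of_not_through h]

theorem move_injective : Function.Injective p.move :=
  Function.LeftInverse.injective p.move_move

theorem move_lt_move {x y : Fin ℓ} (h : x < y) (hp : ¬ (p.Through x ∧ p.Through y)) :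
    p.move x < p.move y := by
  by_cases hx : p.Through x <;> by_cases hy : p.Through y
  · exact absurd ⟨hx, hy⟩ hp
  · have h1 := p.val_move_of_through hx
    rw [p.move_of_not_through hy]
    simp only [Through, Fin.le_def, Fin.lt_def] at *
    omega
  · have h1 := p.val_move_of_through hy
    rw [p.move_of_not_through hx]
    simp only [Through, Fin.le_def, Fin.lt_def] at *
    omega
  · rwa [p.move_of_not_through hx, p.move_of_not_through hy]

theorem move_lt_move_of_through {x y : Fin ℓ} (h : x < y) (hx : p.Through x) (hy : p.Through y) :
    p.move y < p.move x := by
  have h1 := p.val_move_of_through hx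
  have h2 := p.val_move_of_through hy
  simp only [Through, Fin.le_def, Fin.lt_def] at *
  omega

theorem through_of_between {x y z : Fin ℓ} (hxy : x < y) (hyz : y < z) (hx : p.Through x)
    (hz : p.Through z) : p.Through y :=
  ⟨hx.1.trans hxy.le, hyz.le.trans hz.2⟩

theorem card_through : (Finset.univ.filter p.Through).card = p.multiplicity := by
  have h : Finset.univ.filter p.Through = Finset.Icc p.first p.last := by
    ext x
    simp [Through]
  have := p.lt
  rw [h, Fin.card_Icc, multiplicity]
  omega

end LefschetzPair

namespace WiringDiagram

variable {ℓ : ℕ}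

/-- The sets of wires, named by their initial local indices, that meet at the points of a list of
Lefschetz pairs. -/
def wireBlocks : List (LefschetzPair ℓ) → List (Finset (Fin ℓ))
  | [] => []
  | p :: ps => Finset.univ.filter p.Through ::
      (wireBlocks ps).map fun B => Finset.univ.filter fun x => p.move x ∈ B

/-- The position in a list of Lefschetz pairs of the first point at which the wires with initial
local indices `x` and `y` meet. -/
def time : List (LefschetzPair ℓ) → Fin ℓ → Fin ℓ → ℕ
  | [], _, _ => 0
  | p :: ps, x, y => if p.Through x ∧ p.Through y then 0 else time ps (p.move x) (p.move y) + 1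

theorem map_card_wireBlocks (ps : List (LefschetzPair ℓ)) :
    (wireBlocks ps).map Finset.card = ps.map LefschetzPair.multiplicity := by
  induction ps with
  | nil => rfl
  | cons p ps ih =>
    simp only [wireBlocks, List.map_cons, p.card_through, List.map_map, ← ih]
    congr 1
    refine List.map_congr_left fun B _ => ?_
    refine Finset.card_bij (fun x _ => p.move x) ?_ ?_ ?_
    · intro x hx
      simpa using hx
    · intro x _ y _ hxy
      exact p.move_injective hxy
    · intro y hy
      exact ⟨p.move y, by simpa [p.move_move] using hy, p.move_move y⟩

/-- Pulling later blocks back along `move` renames wires by their initial positions, so meetings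
become common membership in blocks. -/
theorem meetings_eq_countP (ps : List (LefschetzPair ℓ)) (x y : Fin ℓ) :
    meetings ps x y = (wireBlocks ps).countP fun B => x ∈ B ∧ y ∈ B := by
  induction ps generalizing x y with
  | nil => rfl
  | cons p ps ih =>
    simp only [meetings, wireBlocks, List.countP_cons, List.countP_map, ih, Finset.mem_filter,
      Finset.mem_univ, true_and, Function.comp_def, decide_eq_true_eq]
    omega

theorem meetings_comm (ps : List (LefschetzPair ℓ)) (x y : Fin ℓ) :
    meetings ps x y = meetings ps y x := by
  simp only [meetings_eq_countP, and_comm]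

theorem time_comm (ps : List (LefschetzPair ℓ)) (x y : Fin ℓ) : time ps x y = time ps y x := by
  induction ps generalizing x y with
  | nil => rfl
  | cons p ps ih => simp only [time, and_comm, ih (p.move x)]

theorem meetings_pos_of_mem {ps : List (LefschetzPair ℓ)} {B : Finset (Fin ℓ)}
    (hB : B ∈ wireBlocks ps) {x y : Fin ℓ} (hx : x ∈ B) (hy : y ∈ B) : 0 < meetings ps x y := by
  rw [meetings_eq_countP, List.countP_pos_iff]
  exact ⟨B, hB, by simp [hx, hy]⟩

/-- This matches zeros of `orientation` with collinear triples. If just one of the two pairs meets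
at the current point, a later common block would make that pair meet twice. -/
theorem time_eq_iff (ps : List (LefschetzPair ℓ)) (x y z : Fin ℓ) (hy : meetings ps x y = 1)
    (hz : meetings ps x z = 1) :
    time ps x y = time ps x z ↔ ∃ B ∈ wireBlocks ps, x ∈ B ∧ y ∈ B ∧ z ∈ B := by
  induction ps generalizing x y z with
  | nil => simp [meetings] at hy
  | cons p ps ih =>
    simp only [meetings] at hy hz
    by_cases h1 : p.Through x ∧ p.Through y <;> by_cases h2 : p.Through x ∧ p.Through z
    · simp only [time, h1, h2, and_self, if_true, true_iff]
      exact ⟨_, List.mem_cons_self, by simp [h1, h2]⟩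
    · simp only [time, if_pos h1, if_neg h2]
      refine iff_of_false (by omega) ?_
      rintro ⟨B, hB, hxB, hyB, hzB⟩
      rcases List.mem_cons.1 hB with rfl | hB
      · simp_all
      · obtain ⟨C, hC, rfl⟩ := List.mem_map.1 hB
        simp only [Finset.mem_filter, Finset.mem_univ, true_and] at hxB hyB hzB
        have := meetings_pos_of_mem hC hxB hyB
        simp only [h1, and_self, if_true] at hy
        omega
    · simp only [time, if_neg h1, if_pos h2]
      refine iff_of_false (by omega) ?_
      rintro ⟨B, hB, hxB, hyB, hzB⟩
      rcases List.mem_cons.1 hB with rfl | hB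
      · simp_all
      · obtain ⟨C, hC, rfl⟩ := List.mem_map.1 hB
        simp only [Finset.mem_filter, Finset.mem_univ, true_and] at hxB hyB hzB
        have := meetings_pos_of_mem hC hxB hzB
        simp only [h2, and_self, if_true] at hz
        omega
    · simp only [h1, h2, if_false, zero_add] at hy hz
      simp only [time, h1, h2, if_false, Nat.add_right_cancel_iff, ih _ _ _ hy hz, wireBlocks,
        List.mem_cons, List.mem_map]
      constructor
      · rintro ⟨B, hB, hxB, hyB, hzB⟩
        exact ⟨_, Or.inr ⟨B, hB, rfl⟩, by simp [hxB, hyB, hzB]⟩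
      · rintro ⟨B, rfl | ⟨C, hC, rfl⟩, hxB, hyB, hzB⟩
        · simp only [Finset.mem_filter, Finset.mem_univ, true_and] at hxB hyB
          exact absurd ⟨hxB, hyB⟩ h1
        · simp only [Finset.mem_filter, Finset.mem_univ, true_and] at hxB hyB hzB
          exact ⟨C, hC, hxB, hyB, hzB⟩

/-- Since `x` and `y` no longer meet, `y` stays between `x` and `z` until it meets `z`. A point
meets an interval of positions, so `x` cannot reach `z` before that. -/
theorem time_lt_of_lower_met (ps : List (LefschetzPair ℓ)) (x y z : Fin ℓ) (hxy : x < y)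
    (hyz : y < z) (h1 : meetings ps x y = 0) (h2 : meetings ps x z = 1)
    (h3 : meetings ps y z = 1) : time ps y z < time ps x z := by
  induction ps generalizing x y z with
  | nil => simp [meetings] at h2
  | cons p ps ih =>
    simp only [meetings, Nat.add_eq_zero_iff, ite_eq_right_iff, one_ne_zero, imp_false] at h1 h2 h3
    have hxz : ¬ (p.Through x ∧ p.Through z) := fun h =>
      h1.1 ⟨h.1, p.through_of_between hxy hyz h.1 h.2⟩
    simp only [time, if_neg hxz]
    split_ifs with h
    · omega
    · rw [if_neg hxz, zero_add] at h2
      rw [if_neg h, zero_add] at h3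
      exact Nat.succ_lt_succ (ih _ _ _ (p.move_lt_move hxy h1.1) (p.move_lt_move hyz h) h1.2 h2 h3)

theorem time_lt_of_upper_met (ps : List (LefschetzPair ℓ)) (x y z : Fin ℓ) (hxy : x < y)
    (hyz : y < z) (h1 : meetings ps y z = 0) (h2 : meetings ps x z = 1)
    (h3 : meetings ps x y = 1) : time ps x y < time ps x z := by
  induction ps generalizing x y z with
  | nil => simp [meetings] at h2
  | cons p ps ih =>
    simp only [meetings, Nat.add_eq_zero_iff, ite_eq_right_iff, one_ne_zero, imp_false] at h1 h2 h3
    have hxz : ¬ (p.Through x ∧ p.Through z) := fun h =>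
      h1.1 ⟨p.through_of_between hxy hyz h.1 h.2, h.2⟩
    simp only [time, if_neg hxz]
    split_ifs with h
    · omega
    · rw [if_neg hxz, zero_add] at h2
      rw [if_neg h, zero_add] at h3
      exact Nat.succ_lt_succ (ih _ _ _ (p.move_lt_move hxy h) (p.move_lt_move hyz h1.1) h1.2 h2 h3)

/-- The crossing of the outer two of three wires lies between the other two crossings. -/
theorem time_between (ps : List (LefschetzPair ℓ)) (x y z : Fin ℓ) (hxy : x < y)
    (hyz : y < z) (h1 : meetings ps x y = 1) (h2 : meetings ps x z = 1)
    (h3 : meetings ps y z = 1) :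
    (time ps x y < time ps x z ∧ time ps x z < time ps y z) ∨
      (time ps y z < time ps x z ∧ time ps x z < time ps x y) ∨
      (time ps x y = time ps x z ∧ time ps x z = time ps y z) := by
  induction ps generalizing x y z with
  | nil => simp [meetings] at h2
  | cons p ps ih =>
    simp only [meetings] at h1 h2 h3
    by_cases hxz : p.Through x ∧ p.Through z
    · have hy := p.through_of_between hxy hyz hxz.1 hxz.2
      simp [time, hxz, hy]
    rw [if_neg hxz, zero_add] at h2
    by_cases hx : p.Through x ∧ p.Through y
    · have hz : ¬ (p.Through y ∧ p.Through z) := fun h => hxz ⟨hx.1, h.2⟩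
      rw [if_neg hz, zero_add] at h3
      rw [if_pos hx] at h1
      -- Behind the crossing of `x` and `y` the order is `y, x, z`, and the lower two have finished
      -- meeting.
      have h4 := time_lt_of_lower_met ps _ _ _ (p.move_lt_move_of_through hxy hx.1 hx.2)
        (p.move_lt_move (hxy.trans hyz) hxz) (by rw [meetings_comm]; omega) h3 h2
      simp only [time, if_neg hz, if_neg hxz, if_pos hx]
      omega
    rw [if_neg hx, zero_add] at h1
    by_cases hz : p.Through y ∧ p.Through z
    · rw [if_pos hz] at h3
      have h4 := time_lt_of_upper_met ps _ _ _ (p.move_lt_move (hxy.trans hyz) hxz)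
        (p.move_lt_move_of_through hyz hz.1 hz.2) (by rw [meetings_comm]; omega) h1 h2
      simp only [time, if_pos hz, if_neg hxz, if_neg hx]
      omega
    rw [if_neg hz, zero_add] at h3
    have h4 := ih _ _ _ (p.move_lt_move hxy hx) (p.move_lt_move hyz hz) h1 h2 h3
    simp only [time, if_neg hx, if_neg hxz, if_neg hz]
    omega

/-- The sign that records on which side of a wire another wire starts. -/
noncomputable def side (x y : Fin ℓ) : ℝ := if x < y then 1 else if y < x then -1 else 0

/-- The orientation of three wires. -/
noncomputable def orientation (ps : List (LefschetzPair ℓ)) (x y z : Fin ℓ) : ℝ :=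
  side x y * side x z * (time ps x z - time ps x y)

/-- In the Plücker relation the `side` factors are common to all terms, and the rest is the identity
for differences of four numbers. Cyclic invariance of the sign is where geometry enters: for `x < y
< z` the three rotations compare pairs of the times of `xy`, `xz`, `yz`, which `time_between` puts
in monotone order. -/
theorem isSignDeterminant_orientation (D : WiringDiagram ℓ) (h : D.UniqueIntersection) :
    IsSignDeterminant (orientation D.pairs) where
  swap x y z := by unfold orientation; ring
  rotate x y z := by
    have hb := time_between D.pairs
    have key : ∀ x y z, x < y → y < z →
        (orientation D.pairs x y z < 0 ↔ orientation D.pairs y z x < 0) ∧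
        (orientation D.pairs x y z < 0 ↔ orientation D.pairs z x y < 0) ∧
        (orientation D.pairs x z y < 0 ↔ orientation D.pairs z y x < 0) ∧
        (orientation D.pairs x z y < 0 ↔ orientation D.pairs y x z < 0) := by
      intro x y z hxy hyz
      have h1 := hb x y z hxy hyz (h x y hxy.ne) (h x z (hxy.trans hyz).ne) (h y z hyz.ne)
      rw [← @Nat.cast_lt ℝ, ← @Nat.cast_lt ℝ, ← @Nat.cast_lt ℝ, ← @Nat.cast_lt ℝ,
        ← @Nat.cast_inj ℝ, ← @Nat.cast_inj ℝ] at h1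
      simp only [orientation, side, hxy, hyz, hxy.trans hyz, hxy.not_gt, hyz.not_gt,
        (hxy.trans hyz).not_gt, if_true, if_false, time_comm D.pairs y x, time_comm D.pairs z x,
        time_comm D.pairs z y]
      rcases h1 with h1 | h1 | h1 <;>
        refine ⟨⟨?_, ?_⟩, ⟨?_, ?_⟩, ⟨?_, ?_⟩, ⟨?_, ?_⟩⟩ <;> intro <;> linarith
    rcases lt_trichotomy x y with hxy | hxy | hxy <;>
      rcases lt_trichotomy y z with hyz | hyz | hyz <;>
      rcases lt_trichotomy x z with hxz | hxz | hxz
    all_goals first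
      | (exfalso; omega)
      | (subst_vars; simp [orientation, side]; done)
      | grind
  plucker a b c d e := by unfold orientation; ring

theorem isLinearSpace_wireBlocks (D : WiringDiagram ℓ) (h : D.UniqueIntersection) :
    IsLinearSpace (wireBlocks D.pairs).toFinset := by
  have hone : ∀ x y, x ≠ y → ∃ C, (wireBlocks D.pairs).filter (fun B => x ∈ B ∧ y ∈ B) = [C] := by
    intro x y hxy
    have := h x y hxy
    rwa [meetings_eq_countP, List.countP_eq_length_filter, List.length_eq_one_iff] at this
  refine ⟨?_, ?_, ?_⟩
  · intro B hB
    have h1 := List.mem_map_of_mem (f := Finset.card) (List.mem_toFinset.1 hB)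
    rw [map_card_wireBlocks] at h1
    obtain ⟨p, -, hp⟩ := List.mem_map.1 h1
    have := p.lt
    rw [← hp, LefschetzPair.multiplicity]
    omega
  · intro x y hxy
    obtain ⟨C, hC⟩ := hone x y hxy
    have h1 : C ∈ (wireBlocks D.pairs).filter (fun B => x ∈ B ∧ y ∈ B) := by
      rw [hC]
      exact List.mem_singleton_self C
    rw [List.mem_filter] at h1
    exact ⟨C, List.mem_toFinset.2 h1.1, by simpa using h1.2⟩
  · intro B hB C hC x y hxy hxB hyB hxC hyC
    obtain ⟨E, hE⟩ := hone x y hxy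
    have h1 : ∀ F ∈ (wireBlocks D.pairs).toFinset, x ∈ F → y ∈ F → F = E := by
      intro F hF hx hy
      have h2 : F ∈ (wireBlocks D.pairs).filter (fun B => x ∈ B ∧ y ∈ B) :=
        List.mem_filter.2 ⟨List.mem_toFinset.1 hF, by simp [hx, hy]⟩
      rw [hE] at h2
      simpa using h2
    rw [h1 B hB hxB hyB, h1 C hC hxC hyC]

/-- Two wires of a repeated block would meet twice. Hence passing from the list to a finset loses no
points of the diagram. -/
theorem nodup_wireBlocks (D : WiringDiagram ℓ) (h : D.UniqueIntersection) :
    (wireBlocks D.pairs).Nodup := by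
  rw [List.nodup_iff_count_le_one]
  intro B
  by_cases hB : B ∈ wireBlocks D.pairs
  · have h2 := (isLinearSpace_wireBlocks D h).two_le B (List.mem_toFinset.2 hB)
    obtain ⟨x, hx, y, hy, hxy⟩ := Finset.one_lt_card.1 h2
    rw [← h x y hxy, meetings_eq_countP]
    refine List.countP_mono_left fun C _ hC => ?_
    rw [beq_iff_eq] at hC
    simp [hC, hx, hy]
  · rw [List.count_eq_zero_of_not_mem hB]
    exact zero_le_one

theorem signature_eq_blockSignature (D : WiringDiagram 8) (h : D.UniqueIntersection) :
    D.signature = blockSignature (wireBlocks D.pairs).toFinset := by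
  funext k
  rw [signature, ← map_card_wireBlocks, List.count_eq_countP, List.countP_map,
    List.countP_eq_length_filter, blockSignature,
    ← List.toFinset_card_of_nodup ((nodup_wireBlocks D h).filter _)]
  congr 1
  ext B
  simp

theorem signature_ne (D : WiringDiagram 8) (h : D.UniqueIntersection) :
    D.signature ≠ pts 2 4 + pts 3 8 := by
  rw [D.signature_eq_blockSignature h]
  refine (isLinearSpace_wireBlocks D h).blockSignature_ne (D.isSignDeterminant_orientation h) ?_
  rintro x y z ⟨hxy, hxz, -⟩
  have hside : ∀ {x y : Fin 8}, x ≠ y → side x y ≠ 0 := by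
    intro x y hne
    unfold side
    rcases hne.lt_or_gt with h1 | h1
    · simp [h1]
    · simp [h1, h1.not_gt]
  rw [orientation, mul_eq_zero, or_iff_right (mul_ne_zero (hside hxy) (hside hxz)), sub_eq_zero,
    Nat.cast_inj, eq_comm, time_eq_iff _ _ _ _ (h x y hxy) (h x z hxz)]
  simp only [List.mem_toFinset]

end WiringDiagram

/-! ### Realization by explicit integer equations -/

/-- Equations with integer coefficients, as equations over the reals. -/
def LineEquation.toReal (l : LineEquation ℤ) : LineEquation ℝ := ⟨l.a, l.b, l.c⟩

-- Moves the determinants to `ℤ`, where equality is decidable by computation and the kernel can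
-- evaluate the signature.
open Classical in
theorem lineBlocks_toReal (e : Fin 8 → LineEquation ℤ) :
    lineBlocks (fun i => (e i).toReal) = lineBlocks e := by
  have h : ∀ i j k, LineEquation.det (e i).toReal (e j).toReal (e k).toReal =
      (LineEquation.det (e i) (e j) (e k) : ℤ) := by
    intro i j k
    simp [LineEquation.det, LineEquation.toReal]
  unfold lineBlocks
  simp only [h, Int.cast_eq_zero]

open Classical in
/-- Integer equations of pairwise intersecting lines realize the signature of their blocks. -/
theorem exists_arrangement (e : Fin 8 → LineEquation ℤ) (n₂ n₃ n₄ n₅ n₆ n₇ n₈ : ℕ)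
    (he : ∀ i j, i ≠ j → LineEquation.normalDet (e i) (e j) ≠ 0)
    (hs : [2, 3, 4, 5, 6, 7, 8].map (blockSignature (lineBlocks e)) =
      [n₂, n₃, n₄, n₅, n₆, n₇, n₈]) :
    ∃ A : RealLineArrangement 8, A.PairwiseMeeting ∧ A.signature =
      pts 2 n₂ + pts 3 n₃ + pts 4 n₄ + pts 5 n₅ + pts 6 n₆ + pts 7 n₇ + pts 8 n₈ := by
  have he' : ∀ i j, i ≠ j → LineEquation.normalDet (e i).toReal (e j).toReal ≠ 0 := by
    intro i j hij h0
    apply he i j hij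
    simp only [LineEquation.normalDet, LineEquation.toReal] at h0 ⊢
    exact_mod_cast h0
  have hmeet : ∀ i j, i ≠ j → ((e i).toReal.points ∩ (e j).toReal.points).Nonempty :=
    fun i j hij => ⟨_, LineEquation.inter_mem_left (he' i j hij),
      LineEquation.inter_mem_right (he' i j hij)⟩
  have hnormal : ∀ i, (e i).toReal.a ≠ 0 ∨ (e i).toReal.b ≠ 0 := by
    intro i
    obtain ⟨j, hj⟩ := exists_ne i
    by_contra! h0
    apply he' i j hj.symm
    simp [LineEquation.normalDet, h0.1, h0.2]
  let A : RealLineArrangement 8 :=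
    { line := fun i => (e i).toReal.points
      isLine := fun i => ⟨_, _, _, hnormal i, rfl⟩
      distinct := by
        intro i j hij
        by_contra hne
        obtain ⟨P, hPi, hPj⟩ := hmeet i j hne
        apply he' i j hne
        -- A second point of line `i`, shifted along its direction vector. If it also lay on line
        -- `j`, the difference of the two equations would give `normalDet = 0`.
        have hQ : (P.1 - (e i).toReal.b, P.2 + (e i).toReal.a) ∈ (e i).toReal.points := by
          simp only [LineEquation.points, Set.mem_ofPred_eq] at hPi ⊢
          linear_combination hPi
        simp only at hij
        rw [hij] at hQ
        simp only [LineEquation.points, Set.mem_ofPred_eq] at hQ hPj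
        unfold LineEquation.normalDet
        linear_combination hQ - hPj }
  have hA : A.signature = blockSignature (lineBlocks e) := by
    rw [← lineBlocks_toReal]
    exact A.signature_eq_blockSignature (fun _ => rfl) he'
  refine ⟨A, fun i j => ?_, ?_⟩
  · by_cases hij : i = j
    · subst hij
      obtain ⟨j, hj⟩ := exists_ne i
      obtain ⟨P, hP, -⟩ := hmeet i j hj.symm
      exact ⟨P, hP, hP⟩
    · exact hmeet i j hij
  · have hlin : IsLinearSpace (lineBlocks e) := by
      rw [← lineBlocks_toReal]
      exact isLinearSpace_lineBlocks he'
    rw [hA, blockSignature_eq_sum_pts hlin]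
    simp only [List.map_cons, List.map_nil, List.cons.injEq, and_true] at hs
    rw [hs.1, hs.2.1, hs.2.2.1, hs.2.2.2.1, hs.2.2.2.2.1, hs.2.2.2.2.2.1, hs.2.2.2.2.2.2]

/-- The signatures that are realized by eight lines. -/
theorem signature_realizable : ∀ S ∈ ({ pts 8 1, pts 2 7 + pts 7 1, pts 2 4 + pts 3 6 + pts 4 1,
      pts 2 10 + pts 3 1 + pts 6 1,
      pts 2 7 + pts 3 3 + pts 4 2, pts 2 9 + pts 3 3 + pts 5 1, pts 2 7 + pts 3 5 + pts 4 1,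
      pts 2 12 + pts 4 1 + pts 5 1, pts 2 13 + pts 6 1, pts 2 7 + pts 3 7,
      pts 2 10 + pts 3 2 + pts 4 2, pts 2 12 + pts 3 2 + pts 5 1,
      pts 2 10 + pts 3 4 + pts 4 1, pts 2 10 + pts 3 6, pts 2 13 + pts 3 1 + pts 4 2,
      pts 2 15 + pts 3 1 + pts 5 1, pts 2 13 + pts 3 3 + pts 4 1, pts 2 13 + pts 3 5,
      pts 2 16 + pts 4 2, pts 2 18 + pts 5 1, pts 2 16 + pts 3 2 + pts 4 1,
      pts 2 16 + pts 3 4, pts 2 19 + pts 3 1 + pts 4 1, pts 2 19 + pts 3 3,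
      pts 2 22 + pts 4 1, pts 2 22 + pts 3 2, pts 2 25 + pts 3 1, pts 2 28 } : Set (ℕ → ℕ)),
    ∃ A : RealLineArrangement 8, A.PairwiseMeeting ∧ A.signature = S := by
  have p0 : ∀ k, pts k 0 = 0 := fun k => Pi.single_zero k
  intro S hS
  simp only [Set.mem_insert_iff, Set.mem_singleton_iff] at hS
  rcases hS with rfl | rfl | rfl | rfl | rfl | rfl | rfl | rfl | rfl | rfl | rfl | rfl | rfl |
    rfl | rfl | rfl | rfl | rfl | rfl | rfl | rfl | rfl | rfl | rfl | rfl | rfl | rfl | rfl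
  -- In each case the triples are coefficients `a, b, c` of `a x + b y = c`, and the seven numbers
  -- are `n_2, …, n_8`. Here all eight lines pass through the origin.
  · simpa [p0] using exists_arrangement
      ![⟨1, 0, 0⟩, ⟨1, 1, 0⟩, ⟨1, 2, 0⟩, ⟨1, 3, 0⟩, ⟨1, 4, 0⟩, ⟨1, 5, 0⟩, ⟨1, 6, 0⟩, ⟨1, 7, 0⟩]
      0 0 0 0 0 0 1 (by decide) (by decide +kernel)
  · simpa [p0] using exists_arrangement
      ![⟨0, 1, 0⟩, ⟨1, -2, 0⟩, ⟨1, -1, 0⟩, ⟨1, 0, 0⟩, ⟨1, 1, -2⟩, ⟨1, 2, 0⟩, ⟨2, -1, 0⟩, ⟨2, 1, 0⟩]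
      7 0 0 0 0 1 0 (by decide) (by decide +kernel)
  · simpa [p0] using exists_arrangement
      ![⟨0, 1, 0⟩, ⟨1, -2, 0⟩, ⟨1, -1, 1⟩, ⟨1, 0, 0⟩, ⟨1, 1, 1⟩, ⟨1, 2, 0⟩, ⟨2, -1, 1⟩, ⟨2, 1, 1⟩]
      4 6 1 0 0 0 0 (by decide) (by decide +kernel)
  · simpa [p0] using exists_arrangement
      ![⟨0, 1, 0⟩, ⟨1, -1, 0⟩, ⟨1, 0, 0⟩, ⟨1, 1, 0⟩, ⟨2, -3, 1⟩, ⟨2, -1, 0⟩, ⟨2, 1, -1⟩, ⟨3, 1, 0⟩]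
      10 1 0 0 1 0 0 (by decide) (by decide +kernel)
  · simpa [p0] using exists_arrangement
      ![⟨0, 1, 0⟩, ⟨1, -2, -1⟩, ⟨1, -1, 0⟩, ⟨1, 1, -1⟩,
        ⟨1, 2, 0⟩, ⟨2, -1, -2⟩, ⟨2, 0, -1⟩, ⟨2, 1, 0⟩]
      7 3 2 0 0 0 0 (by decide) (by decide +kernel)
  · simpa [p0] using exists_arrangement
      ![⟨0, 1, 1⟩, ⟨1, -2, -1⟩, ⟨1, -1, 0⟩, ⟨1, 0, 0⟩,
        ⟨1, 1, 2⟩, ⟨1, 2, 1⟩, ⟨2, -1, 1⟩, ⟨2, 1, -1⟩]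
      9 3 0 1 0 0 0 (by decide) (by decide +kernel)
  · simpa [p0] using exists_arrangement
      ![⟨0, 1, 0⟩, ⟨1, -2, -1⟩, ⟨1, -1, -1⟩, ⟨1, 0, 0⟩,
        ⟨1, 1, 0⟩, ⟨1, 2, 0⟩, ⟨2, -1, -1⟩, ⟨2, 1, -1⟩]
      7 5 1 0 0 0 0 (by decide) (by decide +kernel)
  · simpa [p0] using exists_arrangement
      ![⟨0, 1, 0⟩, ⟨1, -3, 1⟩, ⟨1, -1, 0⟩, ⟨1, 0, 1⟩, ⟨1, 1, 2⟩, ⟨1, 3, 1⟩, ⟨2, -3, 2⟩, ⟨2, -1, 1⟩]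
      12 0 1 1 0 0 0 (by decide) (by decide +kernel)
  · simpa [p0] using exists_arrangement
      ![⟨0, 1, 0⟩, ⟨1, -2, 0⟩, ⟨1, -1, 0⟩, ⟨1, 0, 0⟩,
        ⟨1, 1, 0⟩, ⟨1, 3, -3⟩, ⟨2, -1, -1⟩, ⟨2, 1, 0⟩]
      13 0 0 0 1 0 0 (by decide) (by decide +kernel)
  · simpa [p0] using exists_arrangement
      ![⟨0, 1, -1⟩, ⟨1, -2, 0⟩, ⟨1, -1, -1⟩, ⟨1, 0, 0⟩,
        ⟨1, 1, 1⟩, ⟨1, 3, -1⟩, ⟨2, 1, -1⟩, ⟨3, 2, 0⟩]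
      7 7 0 0 0 0 0 (by decide) (by decide +kernel)
  · simpa [p0] using exists_arrangement
      ![⟨0, 1, 0⟩, ⟨1, -1, -1⟩, ⟨1, 0, -1⟩, ⟨1, 1, -1⟩,
        ⟨1, 2, 1⟩, ⟨2, -1, 0⟩, ⟨2, 1, 0⟩, ⟨2, 3, 0⟩]
      10 2 2 0 0 0 0 (by decide) (by decide +kernel)
  · simpa [p0] using exists_arrangement
      ![⟨0, 1, -1⟩, ⟨1, -3, 1⟩, ⟨1, -1, 0⟩, ⟨1, 0, 0⟩,
        ⟨1, 1, -1⟩, ⟨1, 2, 0⟩, ⟨2, 1, -1⟩, ⟨3, 2, -2⟩]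
      12 2 0 1 0 0 0 (by decide) (by decide +kernel)
  · simpa [p0] using exists_arrangement
      ![⟨0, 1, 1⟩, ⟨1, -2, -1⟩, ⟨1, -1, -1⟩, ⟨1, 0, 0⟩,
        ⟨1, 1, 0⟩, ⟨1, 2, 0⟩, ⟨2, -1, -1⟩, ⟨2, 1, -1⟩]
      10 4 1 0 0 0 0 (by decide) (by decide +kernel)
  · simpa [p0] using exists_arrangement
      ![⟨0, 1, 0⟩, ⟨1, -2, 1⟩, ⟨1, -1, 0⟩, ⟨1, 0, -1⟩,
        ⟨1, 1, 0⟩, ⟨1, 2, -1⟩, ⟨2, -1, 1⟩, ⟨2, 1, -1⟩]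
      10 6 0 0 0 0 0 (by decide) (by decide +kernel)
  · simpa [p0] using exists_arrangement
      ![⟨0, 1, 0⟩, ⟨1, -1, 1⟩, ⟨1, 0, 0⟩, ⟨1, 1, 0⟩, ⟨1, 2, -1⟩, ⟨2, -1, 1⟩, ⟨2, 1, 0⟩, ⟨3, -1, 1⟩]
      13 1 2 0 0 0 0 (by decide) (by decide +kernel)
  · simpa [p0] using exists_arrangement
      ![⟨0, 1, 0⟩, ⟨1, -3, 2⟩, ⟨1, -1, 0⟩, ⟨1, 0, 0⟩,
        ⟨1, 1, -1⟩, ⟨2, -3, 2⟩, ⟨2, -1, 0⟩, ⟨2, 1, 0⟩]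
      15 1 0 1 0 0 0 (by decide) (by decide +kernel)
  · simpa [p0] using exists_arrangement
      ![⟨0, 1, 0⟩, ⟨1, -1, -1⟩, ⟨1, 0, -1⟩, ⟨1, 1, 1⟩, ⟨1, 2, 1⟩, ⟨1, 3, 1⟩, ⟨2, -1, 0⟩, ⟨3, 2, 1⟩]
      13 3 1 0 0 0 0 (by decide) (by decide +kernel)
  · simpa [p0] using exists_arrangement
      ![⟨0, 1, 0⟩, ⟨1, -2, -1⟩, ⟨1, -1, 2⟩, ⟨1, 0, -1⟩,
        ⟨1, 1, 0⟩, ⟨1, 3, 2⟩, ⟨2, -1, 1⟩, ⟨3, 1, 0⟩]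
      13 5 0 0 0 0 0 (by decide) (by decide +kernel)
  · simpa [p0] using exists_arrangement
      ![⟨0, 1, 1⟩, ⟨1, -2, -1⟩, ⟨1, -1, -1⟩, ⟨1, 0, -1⟩,
        ⟨1, 1, 1⟩, ⟨1, 2, -2⟩, ⟨2, -1, -1⟩, ⟨2, 1, -2⟩]
      16 0 2 0 0 0 0 (by decide) (by decide +kernel)
  · simpa [p0] using exists_arrangement
      ![⟨1, -2, -1⟩, ⟨1, -1, 0⟩, ⟨1, 0, 0⟩, ⟨1, 3, 0⟩,
        ⟨3, -1, 0⟩, ⟨3, 1, 0⟩, ⟨3, 2, -3⟩, ⟨3, 3, -2⟩]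
      18 0 0 1 0 0 0 (by decide) (by decide +kernel)
  · simpa [p0] using exists_arrangement
      ![⟨0, 1, 1⟩, ⟨1, -2, -1⟩, ⟨1, -1, -1⟩, ⟨1, 0, 1⟩,
        ⟨1, 1, 0⟩, ⟨2, -1, 0⟩, ⟨3, -1, 1⟩, ⟨3, 1, 1⟩]
      16 2 1 0 0 0 0 (by decide) (by decide +kernel)
  · simpa [p0] using exists_arrangement
      ![⟨0, 1, 0⟩, ⟨1, -3, 1⟩, ⟨1, -2, 1⟩, ⟨1, 0, 0⟩, ⟨1, 1, 0⟩, ⟨2, 1, 1⟩, ⟨3, -2, 2⟩, ⟨3, 1, 1⟩]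
      16 4 0 0 0 0 0 (by decide) (by decide +kernel)
  · simpa [p0] using exists_arrangement
      ![⟨0, 1, 1⟩, ⟨1, -1, -1⟩, ⟨1, 0, 0⟩, ⟨1, 3, 1⟩, ⟨2, -1, 1⟩, ⟨2, 1, 0⟩, ⟨3, 1, 0⟩, ⟨3, 2, 0⟩]
      19 1 1 0 0 0 0 (by decide) (by decide +kernel)
  · simpa [p0] using exists_arrangement
      ![⟨0, 1, -2⟩, ⟨1, -2, 0⟩, ⟨1, -1, 2⟩, ⟨1, 1, 3⟩,
        ⟨2, -3, -2⟩, ⟨3, -2, 1⟩, ⟨3, 1, -2⟩, ⟨3, 2, -1⟩]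
      19 3 0 0 0 0 0 (by decide) (by decide +kernel)
  · simpa [p0] using exists_arrangement
      ![⟨0, 1, 0⟩, ⟨1, -3, 2⟩, ⟨1, 1, 0⟩, ⟨1, 2, -1⟩,
        ⟨1, 3, -2⟩, ⟨2, -1, 2⟩, ⟨3, -2, -1⟩, ⟨3, 2, 1⟩]
      22 0 1 0 0 0 0 (by decide) (by decide +kernel)
  · simpa [p0] using exists_arrangement
      ![⟨0, 2, 1⟩, ⟨1, -2, -2⟩, ⟨1, 1, -2⟩, ⟨2, -1, 2⟩,
        ⟨2, 3, 4⟩, ⟨2, 4, 1⟩, ⟨3, -2, 1⟩, ⟨3, 4, 2⟩]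
      22 2 0 0 0 0 0 (by decide) (by decide +kernel)
  · simpa [p0] using exists_arrangement
      ![⟨1, 3, -1⟩, ⟨2, -3, 2⟩, ⟨2, -2, 1⟩, ⟨2, -1, 2⟩,
        ⟨3, -2, 1⟩, ⟨3, 1, 1⟩, ⟨3, 2, -1⟩, ⟨3, 3, -1⟩]
      25 1 0 0 0 0 0 (by decide) (by decide +kernel)
  · simpa [p0] using exists_arrangement
      ![⟨0, 3, 1⟩, ⟨1, -3, -1⟩, ⟨1, -1, -3⟩, ⟨2, -3, 2⟩,
        ⟨2, 1, 4⟩, ⟨2, 2, 1⟩, ⟨3, -2, -2⟩, ⟨3, -1, -1⟩]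
      28 0 0 0 0 0 0 (by decide) (by decide +kernel)

/-! ### The classification -/

theorem mainTheorem2 :
    {S : ℕ → ℕ | ∃ A : RealLineArrangement 8, A.PairwiseMeeting ∧ A.signature = S} =
      { pts 8 1, pts 2 7 + pts 7 1, pts 2 4 + pts 3 6 + pts 4 1, pts 2 10 + pts 3 1 + pts 6 1,
        pts 2 7 + pts 3 3 + pts 4 2, pts 2 9 + pts 3 3 + pts 5 1, pts 2 7 + pts 3 5 + pts 4 1,
        pts 2 12 + pts 4 1 + pts 5 1, pts 2 13 + pts 6 1, pts 2 7 + pts 3 7,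
        pts 2 10 + pts 3 2 + pts 4 2, pts 2 12 + pts 3 2 + pts 5 1,
        pts 2 10 + pts 3 4 + pts 4 1, pts 2 10 + pts 3 6, pts 2 13 + pts 3 1 + pts 4 2,
        pts 2 15 + pts 3 1 + pts 5 1, pts 2 13 + pts 3 3 + pts 4 1, pts 2 13 + pts 3 5,
        pts 2 16 + pts 4 2, pts 2 18 + pts 5 1, pts 2 16 + pts 3 2 + pts 4 1,
        pts 2 16 + pts 3 4, pts 2 19 + pts 3 1 + pts 4 1, pts 2 19 + pts 3 3,
        pts 2 22 + pts 4 1, pts 2 22 + pts 3 2, pts 2 25 + pts 3 1, pts 2 28 } ∧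
    ¬ ∃ D : WiringDiagram 8, D.UniqueIntersection ∧ D.signature = pts 2 4 + pts 3 8 := by

  refine ⟨Set.Subset.antisymm ?_ signature_realizable, ?_⟩
  · rintro S ⟨A, hA, rfl⟩
    obtain ⟨𝓑, h𝓑, hs, hne⟩ := A.exists_isLinearSpace hA
    rw [hs]
    exact (blockSignature_mem h𝓑).resolve_right hne
  · rintro ⟨D, hD, hs⟩
    exact D.signature_ne hD hs
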